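/- For integers $n\ge 1$ and $r_n\ge 0$ let, for $x=(x_1,\dots,x_n)\in\mathbb{R}^n$ with indices read modulo $n$ (so $x_{n+k}=x_k$), $$H_n(x)=-\frac{1}{2r_n}\sum_{i=1}^n\sum_{j=1}^{r_n}x_ix_{i+j},\qquad T_n(x)=\frac{x_1^2+\cdots+x_n^2}{n},\qquad S_n(x)=x_1+\cdots+x_n$$ (with $H_n=0$ if $r_n=0$), and let $\mu_n$ be the probability measure on $\mathbb{R}^n$ $$d\mu_n(x)=\frac{1}{Z_n}\exp\left(-\frac{H_n(x)}{T_n(x)}\right)\mathbf{1}_{\{T_n(x)>0\}}\prod_{i=1}^n d\nu(x_i),$$ where $\nu$ is the standard normal distribution on $\mathbb{R}$ and $Z_n$ is the normalization constant. **Theorem.** If $r_n/\sqrt{n}\to\infty$ and $r_n/n^{3/4}\to 0$ as $n\to\infty$ (so that $0<2r_n<n$ for all large $n$), then under the law $\mu_n$ we have the convergence in distribution $$\frac{S_n}{r_n^{1/3}\sqrt{n}}\ \longrightarrow\ \mathcal{N}\left(0,\sqrt[3]{2/3}\right),$$ the centred normal law with variance $(2/3)^{1/3}$. -/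

import Mathlib

open MeasureTheory ProbabilityTheory Filter Topology
open scoped NNReal ENNReal

namespace SpinChain

/-- The Hamiltonian `H_n(x) = -(1 / (2 r)) ∑_i ∑_{j=1}^r x_i x_{i+j}` of the periodic chain of `n`
spins with interaction range `r`. Addition in `Fin n` is modulo `n`, which is the convention
`x_{n+k} = x_k`. -/
noncomputable def hamiltonian (n : ℕ) [NeZero n] (r : ℕ) (x : Fin n → ℝ) : ℝ :=
  -(1 / (2 * (r : ℝ))) * ∑ i : Fin n, ∑ j ∈ Finset.Icc 1 r, x i * x (i + Fin.ofNat n j)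

/-- The self-adjusted temperature `T_n(x) = (x_1² + ⋯ + x_n²) / n`. -/
noncomputable def temperature (n : ℕ) (x : Fin n → ℝ) : ℝ :=
  (∑ i, x i ^ 2) / n

/-- The magnetization `S_n(x) = x_1 + ⋯ + x_n`. -/
noncomputable def magnetization (n : ℕ) (x : Fin n → ℝ) : ℝ :=
  ∑ i, x i

/-- The standard normal distribution on `ℝ^n` (product of `n` standard normal laws). -/
noncomputable def gaussianSpins (n : ℕ) : Measure (Fin n → ℝ) :=
  Measure.pi fun _ => gaussianReal 0 1

/-- The unnormalized density `exp (-H_n / T_n) 1_{T_n > 0}`. -/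
noncomputable def weight (n : ℕ) [NeZero n] (r : ℕ) : (Fin n → ℝ) → ℝ :=
  {x | 0 < temperature n x}.indicator
    fun x => Real.exp (-(hamiltonian n r x / temperature n x))

/-- The normalization constant `Z_n`. -/
noncomputable def partitionFunction (n : ℕ) [NeZero n] (r : ℕ) : ℝ :=
  ∫ x, weight n r x ∂gaussianSpins n

/-- The law `μ_n` of the spins. -/
noncomputable def spinLaw (n : ℕ) [NeZero n] (r : ℕ) : Measure (Fin n → ℝ) :=
  (gaussianSpins n).withDensity fun x =>
    ENNReal.ofReal (1 / partitionFunction n r * weight n r x)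

instance (n : ℕ) : IsProbabilityMeasure (gaussianSpins n) := by
  unfold gaussianSpins; infer_instance

theorem measurable_weight (n : ℕ) [NeZero n] (r : ℕ) : Measurable (weight n r) := by
  have hT : Measurable (temperature n) := by unfold temperature; fun_prop
  have hH : Measurable (hamiltonian n r) := by unfold hamiltonian; fun_prop
  exact Measurable.indicator (by fun_prop) (measurableSet_lt measurable_const hT)

theorem weight_nonneg (n : ℕ) [NeZero n] (r : ℕ) (x : Fin n → ℝ) : 0 ≤ weight n r x :=
  Set.indicator_nonneg (fun _ _ => (Real.exp_pos _).le) x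

theorem weight_le (n : ℕ) [NeZero n] (r : ℕ) (x : Fin n → ℝ) :
    weight n r x ≤ Real.exp (1 / (2 * (r : ℝ)) * (n * (r * n))) := by
  unfold weight
  by_cases hx : 0 < temperature n x
  · rw [Set.indicator_of_mem (by exact hx)]
    have hn : (0 : ℝ) < n := by exact_mod_cast Nat.pos_of_ne_zero (NeZero.ne n)
    have hS : ∑ i, x i ^ 2 = n * temperature n x := by
      unfold temperature; field_simp
    have hle : ∀ i, x i ^ 2 ≤ n * temperature n x := fun i => hS ▸
      Finset.single_le_sum (f := fun i => x i ^ 2) (fun i _ => sq_nonneg (x i)) (Finset.mem_univ i)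
    have hprod : ∀ i k, x i * x k ≤ n * temperature n x := fun i k => by
      nlinarith [hle i, hle k, sq_nonneg (x i - x k)]
    have hsum : ∑ i : Fin n, ∑ j ∈ Finset.Icc 1 r, x i * x (i + Fin.ofNat n j)
        ≤ n * (r * (n * temperature n x)) := by
      calc _ ≤ ∑ i : Fin n, ∑ j ∈ Finset.Icc 1 r, n * temperature n x :=
            Finset.sum_le_sum fun i _ => Finset.sum_le_sum fun j _ => hprod _ _
        _ = _ := by simp
    apply Real.exp_le_exp.2
    rw [← neg_div, div_le_iff₀ hx]
    unfold hamiltonian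
    have h0 : (0 : ℝ) ≤ 1 / (2 * (r : ℝ)) := by positivity
    have := mul_le_mul_of_nonneg_left hsum h0
    linarith
  · rw [Set.indicator_of_notMem (by exact hx)]
    positivity

theorem integrable_weight (n : ℕ) [NeZero n] (r : ℕ) :
    Integrable (weight n r) (gaussianSpins n) :=
  Integrable.of_bound (measurable_weight n r).aestronglyMeasurable
    (Real.exp (1 / (2 * (r : ℝ)) * (n * (r * n))))
    (Eventually.of_forall fun x => by
      rw [Real.norm_of_nonneg (weight_nonneg n r x)]; exact weight_le n r x)

theorem weight_pos_ae (n : ℕ) [NeZero n] (r : ℕ) :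
    ∀ᵐ x ∂gaussianSpins n, 0 < weight n r x := by
  have hmp : MeasurePreserving (Function.eval (0 : Fin n)) (gaussianSpins n) (gaussianReal 0 1) :=
    measurePreserving_eval (fun _ : Fin n => gaussianReal 0 1) 0
  have h0 : ∀ᵐ x ∂gaussianSpins n, x (0 : Fin n) ≠ 0 := by
    have : NullSingletonClass (gaussianReal 0 1) := nullSingletonClass_gaussianReal one_ne_zero
    have h : ∀ᵐ y ∂gaussianReal 0 1, y ≠ 0 := by
      rw [ae_iff]; simpa using measure_singleton (μ := gaussianReal 0 1) (0 : ℝ)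
    exact hmp.quasiMeasurePreserving.ae h
  filter_upwards [h0] with x hx
  have hn : (0 : ℝ) < n := by exact_mod_cast Nat.pos_of_ne_zero (NeZero.ne n)
  have hT : 0 < temperature n x := by
    refine div_pos (Finset.sum_pos' (fun i _ => sq_nonneg _) ⟨0, Finset.mem_univ _, ?_⟩) hn
    positivity
  unfold weight
  rw [Set.indicator_of_mem (by exact hT)]
  exact Real.exp_pos _

theorem partitionFunction_pos (n : ℕ) [NeZero n] (r : ℕ) : 0 < partitionFunction n r := by
  refine (integral_pos_iff_support_of_nonneg (weight_nonneg n r) (integrable_weight n r)).2 ?_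
  have h : gaussianSpins n (Function.support (weight n r)) = 1 := by
    rw [← prob_compl_eq_zero_iff (measurableSet_support (measurable_weight n r))]
    refine measure_mono_null ?_ (ae_iff.1 (weight_pos_ae n r))
    intro x hx h
    exact hx h.ne'
  rw [h]; exact one_pos

instance (n : ℕ) [NeZero n] (r : ℕ) : IsProbabilityMeasure (spinLaw n r) where
  measure_univ := by
    have hZ := partitionFunction_pos n r
    unfold spinLaw
    rw [withDensity_apply _ MeasurableSet.univ, Measure.restrict_univ,
      ← ofReal_integral_eq_lintegral_ofReal ((integrable_weight n r).const_mul _)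
        (Eventually.of_forall fun x => mul_nonneg (by positivity) (weight_nonneg n r x)),
      integral_const_mul]
    change ENNReal.ofReal (1 / partitionFunction n r * partitionFunction n r) = 1
    rw [one_div_mul_cancel hZ.ne', ENNReal.ofReal_one]

end SpinChain

/-!
Write `A` for the coupling matrix, so that `-H_n(x) = ⟨x, A x⟩ / 2`, and `λ_k` for its eigenvalues.
The density `exp (-H_n / T_n)` depends on the direction `u` of `x` only, through
`exp (n ⟨u, A u⟩ / 2)`, while under the Gaussian law the norm is independent of the direction.

**Change of the angular law.** For `s > 1` let `y` be the Gaussian vector with covariance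
`(s - A)⁻¹`. Its direction has density proportional to `(s - ⟨u, A u⟩) ^ (-n / 2)`. Hence `μ_n` is the
law of `|z| y / |y|`, with `z` an independent standard Gaussian vector, reweighted by a multiple of
`W = exp (n ψ(p) / 2)`, where `ψ(p) = 1 - p + log p ≤ 0` and
`p = s - ⟨y, A y⟩ / |y|² = ⟨y, (s - A) y⟩ / |y|²` (`exists_lintegral_stdGaussian_radial_angular`,
`integral_magnetization_spinLaw`). In the real orthonormal eigenbasis of Hartley vectors,
`y_k = g_k / √(s - λ_k)` with `g` standard Gaussian, and `S_n(y) = √n y_0`.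

**Saddle point.** Choose `s = 1 + ε` with `∑_k 1 / (s - λ_k) = n`. Then `∑ g_k²` and `|y|²` both have
mean `n`, and both have variance `O(n)` because `∑_k 1 / (s - λ_k)² ≤ 4 n` follows from the equation
for `ε` (`sum_resolvent_sq_le`). So `p - 1` is of order `n ^ (-1 / 2)` and `W` is of order one, with
total mass bounded below. Removing the coordinate `g_0` changes `W` by `O(1 / (ε √n))`, hence `W` is
asymptotically independent of `g_0` and the reweighting does not affect the limit law of `y_0`.
Since `|z| / |y| → 1`, the limit of `S_n / (r ^ (1 / 3) √n)` is that of `g_0 / (√ε r ^ (1 / 3))`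
(`abs_integral_spinLaw_sub_mul_le`).

**Asymptotics of `ε`.** As `A` has trace zero, the equation for `ε` reads
`∑_k λ_k² / (s - λ_k) = n s ε`. With `ρ = r ^ (2 / 3)` and `ε = a / ρ`, the left side times `ρ / n` is
a Riemann sum of mesh `ρ² / n = r ^ (4 / 3) / n → 0` which converges, by dominated convergence, to
`∫ dτ / (a + (2π² / 3) τ²) = π / √(2π² a / 3)`. Equating this with `a` gives `a³ = 3 / 2`
(`tendsto_saddle`), and the limit variance is `1 / a = (2 / 3) ^ (1 / 3)`.
-/

/-! ### Polar coordinates for Gaussian measures -/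

section Polar
open Measure Metric Set

variable {E : Type*} [NormedAddCommGroup E] [MeasurableSpace E] [BorelSpace E]

/-- Integration in polar coordinates: the radial variable carries the density `ρ ^ (dim E - 1)`. -/
theorem lintegral_polar [NormedSpace ℝ E] [FiniteDimensional ℝ E] [Nontrivial E]
    (μ : Measure E) [μ.IsAddHaarMeasure] {f : E → ℝ≥0∞} (hf : Measurable f) :
    ∫⁻ x, f x ∂μ = ∫⁻ u : sphere (0 : E) 1, ∫⁻ ρ : Ioi (0 : ℝ), f (ρ.1 • u.1)
      ∂volumeIoiPow (Module.finrank ℝ E - 1) ∂μ.toSphere := by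
  have hm : Measurable fun p : sphere (0 : E) 1 × Ioi (0 : ℝ) => f (p.2.1 • p.1.1) := by fun_prop
  rw [← lintegral_prod (fun p : sphere (0 : E) 1 × Ioi (0 : ℝ) => f (p.2.1 • p.1.1))
      hm.aemeasurable,
    ← μ.measurePreserving_homeomorphUnitSphereProd.lintegral_comp hm]
  have h : ∀ x : ({0}ᶜ : Set E), ((homeomorphUnitSphereProd E x).2.1 •
      (homeomorphUnitSphereProd E x).1.1) = x.1 := fun x => by
    simpa using smul_inv_smul₀ (norm_ne_zero_iff.2 x.2) x.1
  simp_rw [h]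
  rw [lintegral_subtype_comap (measurableSet_singleton (0 : E)).compl, restrict_compl_singleton]

/-- The scaling of the radial Gaussian integral: `∫ exp (-(ρ a)² / 2) ρ ^ (n - 1) dρ` is proportional
to `a ^ (-n)`. -/
theorem exists_lintegral_exp_volumeIoiPow (n : ℕ) (hn : n ≠ 0) :
    ∃ C : ℝ≥0∞, C ≠ 0 ∧ C ≠ ∞ ∧ ∀ a : ℝ, 0 < a →
      ENNReal.ofReal (a ^ n) * ∫⁻ ρ : Ioi (0 : ℝ), ENNReal.ofReal (Real.exp (-(ρ.1 * a) ^ 2 / 2))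
        ∂volumeIoiPow (n - 1) = C := by
  refine ⟨ENNReal.ofReal ((1 / 2 : ℝ) ^ (-(n : ℝ) / 2) * (1 / 2) * Real.Gamma ((n : ℝ) / 2)), ?_,
    ENNReal.ofReal_ne_top, fun a ha => ?_⟩
  · have hn' : (0 : ℝ) < n := by positivity
    have := Real.Gamma_pos_of_pos (half_pos hn')
    rw [ne_eq, ENNReal.ofReal_eq_zero, not_le]
    positivity
  have hb : (0 : ℝ) < a ^ 2 / 2 := by positivity
  have hq : (-1 : ℝ) < ((n - 1 : ℕ) : ℝ) := lt_of_lt_of_le (by norm_num) (Nat.cast_nonneg _)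
  have hI := integral_rpow_mul_exp_neg_mul_rpow (p := 2) two_pos hq hb
  have hint := integrableOn_rpow_mul_exp_neg_mul_rpow (p := 2) hq two_pos hb
  have hcast : ((n - 1 : ℕ) : ℝ) + 1 = n := by
    rw [Nat.cast_sub (Nat.one_le_iff_ne_zero.2 hn)]; simp
  have hval : ∫⁻ ρ : Ioi (0 : ℝ), ENNReal.ofReal (Real.exp (-(ρ.1 * a) ^ 2 / 2))
        ∂volumeIoiPow (n - 1) = ENNReal.ofReal
          ((a ^ 2 / 2) ^ (-(n : ℝ) / 2) * (1 / 2) * Real.Gamma ((n : ℝ) / 2)) := by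
    rw [← hcast, ← hI, ofReal_integral_eq_lintegral_ofReal hint
      ((ae_restrict_mem measurableSet_Ioi).mono fun x (hx : 0 < x) => by positivity),
      volumeIoiPow, lintegral_withDensity_eq_lintegral_mul _ (by fun_prop) (by fun_prop),
      ← lintegral_subtype_comap measurableSet_Ioi]
    refine lintegral_congr fun ρ => ?_
    have h0 : (0 : ℝ) < ρ.1 := ρ.2
    simp only [Pi.mul_apply]
    rw [← ENNReal.ofReal_mul (by positivity), Real.rpow_natCast, Real.rpow_two]
    congr 3
    ring
  rw [hval, ← ENNReal.ofReal_mul (by positivity)]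
  congr 1
  have : (a ^ 2 / 2) ^ (-(n : ℝ) / 2) = (a ^ n)⁻¹ * (1 / 2 : ℝ) ^ (-(n : ℝ) / 2) := by
    rw [div_eq_mul_one_div, Real.mul_rpow (by positivity) (by positivity), ← Real.rpow_natCast a 2,
      ← Real.rpow_mul ha.le]
    congr 1
    rw [← Real.rpow_natCast a n, ← Real.rpow_neg ha.le]
    congr 1
    push_cast; ring
  rw [this]
  field_simp

/-- The standard Gaussian measure has a density proportional to `exp (-‖x‖² / 2)`; both sides have
the same characteristic function. -/
theorem exists_stdGaussian_eq_smul_withDensity [InnerProductSpace ℝ E] [FiniteDimensional ℝ E] :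
    ∃ c : ℝ≥0∞, c ≠ 0 ∧ c ≠ ∞ ∧ stdGaussian E =
      c • (volume : Measure E).withDensity fun x => ENNReal.ofReal (Real.exp (-‖x‖ ^ 2 / 2)) := by
  set d := Module.finrank ℝ E
  have hpos : (0 : ℝ) < (2 * Real.pi) ^ (-(d : ℝ) / 2) := by positivity
  have hI : Integrable fun x : E => Real.exp (-‖x‖ ^ 2 / 2) := by
    have h := (GaussianFourier.integrable_cexp_neg_mul_sq_norm_add (V := E) (b := 1 / 2)
      (by norm_num) 0 0).norm
    refine h.congr (Eventually.of_forall fun x => ?_)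
    simp only [Complex.norm_exp]
    congr 1
    have : (-(1 / 2 : ℂ) * (‖x‖ : ℂ) ^ 2 + 0 * (inner ℝ (0 : E) x : ℂ)) =
      ((-‖x‖ ^ 2 / 2 : ℝ) : ℂ) := by push_cast; ring
    rw [this, Complex.ofReal_re]
  refine ⟨ENNReal.ofReal ((2 * Real.pi) ^ (-(d : ℝ) / 2)), ?_, ENNReal.ofReal_ne_top, ?_⟩
  · simpa using hpos
  have hfin : IsFiniteMeasure ((volume : Measure E).withDensity fun x =>
      ENNReal.ofReal (Real.exp (-‖x‖ ^ 2 / 2))) :=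
    isFiniteMeasure_withDensity_ofReal hI.2
  have : IsFiniteMeasure (ENNReal.ofReal ((2 * Real.pi) ^ (-(d : ℝ) / 2)) •
    (volume : Measure E).withDensity fun x => ENNReal.ofReal (Real.exp (-‖x‖ ^ 2 / 2))) :=
    Measure.smul_finite _ ENNReal.ofReal_ne_top
  refine Measure.ext_of_charFun (funext fun t => ?_)
  rw [charFun_stdGaussian, charFun_apply, integral_smul_measure,
    integral_withDensity_eq_integral_toReal_smul (by fun_prop) (by simp)]
  have h := GaussianFourier.integral_cexp_neg_mul_sq_norm_add (V := E) (b := 1 / 2)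
      (by norm_num) Complex.I t
  have h2 : ∀ x : E, (ENNReal.ofReal (Real.exp (-‖x‖ ^ 2 / 2))).toReal •
      Complex.exp (inner ℝ x t * Complex.I) =
      Complex.exp (-(1 / 2) * ‖x‖ ^ 2 + Complex.I * inner ℝ t x) := fun x => by
    rw [ENNReal.toReal_ofReal (Real.exp_pos _).le, Complex.real_smul, Complex.ofReal_exp,
      ← Complex.exp_add, real_inner_comm]
    congr 1
    push_cast; ring
  simp_rw [h2]
  rw [h, ENNReal.toReal_ofReal hpos.le, Complex.real_smul, ← mul_assoc]
  have h3 : ((((2 * Real.pi) ^ (-(d : ℝ) / 2) : ℝ)) : ℂ) *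
      ((Real.pi : ℂ) / (1 / 2)) ^ ((Module.finrank ℝ E : ℂ) / 2) = 1 := by
    have e : ((Real.pi : ℂ) / (1 / 2)) ^ ((Module.finrank ℝ E : ℂ) / 2) =
        (((2 * Real.pi) ^ ((d : ℝ) / 2) : ℝ) : ℂ) := by
      rw [Complex.ofReal_cpow (by positivity)]
      push_cast
      congr 1
      ring
    rw [e, ← Complex.ofReal_mul, ← Real.rpow_add (by positivity)]
    simp [neg_div]
  rw [h3, one_mul]
  congr 1
  rw [Complex.I_sq]; ring

/-- Changing the angular law of a Gaussian vector. The direction of `L g`, for `g` standard Gaussian,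
has density proportional to `(‖L g‖ / ‖g‖) ^ n` (a function of the direction of `L g` only) with
respect to the uniform law on the sphere, and the norm of an independent standard Gaussian vector
`z` restores the radial part. -/
theorem exists_lintegral_stdGaussian_radial_angular [InnerProductSpace ℝ E]
    [FiniteDimensional ℝ E] [Nontrivial E] (L : E ≃L[ℝ] E) :
    ∃ C : ℝ≥0∞, C ≠ 0 ∧ C ≠ ∞ ∧ ∀ G : E → ℝ≥0∞, Measurable G →
      ∫⁻ g, ∫⁻ z, G ((‖z‖ / ‖L g‖) • L g) *
        ENNReal.ofReal ((‖g‖ / ‖L g‖) ^ Module.finrank ℝ E) ∂stdGaussian E ∂stdGaussian E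
        = C * ∫⁻ x, G x ∂stdGaussian E := by
  obtain ⟨c, hc0, hc, hγ⟩ := exists_stdGaussian_eq_smul_withDensity (E := E)
  set d := Module.finrank ℝ E
  obtain ⟨B, hB0, hB, hBa⟩ := exists_lintegral_exp_volumeIoiPow d Module.finrank_pos.ne'
  set φ : E → ℝ≥0∞ := fun x => ENNReal.ofReal (Real.exp (-‖x‖ ^ 2 / 2)) with hφ
  have hφm : Measurable φ := by fun_prop
  have hγi : ∀ f : E → ℝ≥0∞, Measurable f →
      ∫⁻ x, f x ∂stdGaussian E = c * ∫⁻ x, f x * φ x := fun f hf => by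
    rw [hγ, lintegral_smul_measure, lintegral_withDensity_eq_lintegral_mul _ hφm hf, smul_eq_mul]
    simp only [Pi.mul_apply, mul_comm]
  have hdet : LinearMap.det (L : E →ₗ[ℝ] E) ≠ 0 :=
    (LinearEquiv.isUnit_det' L.toLinearEquiv).ne_zero
  set D : ℝ≥0∞ := ENNReal.ofReal |(LinearMap.det (L : E →ₗ[ℝ] E))⁻¹| with hD
  have hD0 : D ≠ 0 := by simpa [hD] using hdet
  have hDi : D ≠ ∞ := ENNReal.ofReal_ne_top
  have hmap : Measure.map L (volume : Measure E) = D • (volume : Measure E) :=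
    map_linearMap_addHaar_eq_smul_addHaar volume hdet
  set σ : Measure (sphere (0 : E) 1) := (volume : Measure E).toSphere with hσ
  have hσ0 : σ univ ≠ 0 := measure_univ_ne_zero.2 (toSphere_ne_zero _)
  have hσi : σ univ ≠ ∞ := measure_ne_top _ _
  refine ⟨c * (D * B * σ univ), by positivity, by finiteness, fun G hG => ?_⟩
  set κ : Measure (Ioi (0 : ℝ)) := volumeIoiPow (d - 1)
  -- `J u` is, up to a constant, the average of `G` over the half-line spanned by `u`
  set J : E → ℝ≥0∞ := fun u => ∫⁻ z, G (‖z‖ • u) ∂stdGaussian E with hJ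
  have hJm : Measurable J :=
    Measurable.lintegral_prod_right' (f := fun p : E × E => G (‖p.2‖ • p.1)) (by fun_prop)
  have hJs : ∀ u : sphere (0 : E) 1, J u =
      c * (σ univ * ∫⁻ ρ : Ioi (0 : ℝ), G (ρ.1 • u.1) * φ (ρ.1 • u.1) ∂κ) := fun u => by
    simp only [hJ]
    rw [hγi _ (by fun_prop), lintegral_polar _ (by fun_prop)]
    congr 1
    have : ∀ v : sphere (0 : E) 1, ∀ ρ : Ioi (0 : ℝ), G (‖ρ.1 • v.1‖ • u.1) * φ (ρ.1 • v.1) =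
        G (ρ.1 • u.1) * φ (ρ.1 • u.1) := fun v ρ => by
      simp [hφ, norm_smul, abs_of_pos ρ.2.out]
    simp_rw [this, lintegral_const, mul_comm]
    rfl
  have hleft : ∀ g : E, ∫⁻ z, G ((‖z‖ / ‖L g‖) • L g) * ENNReal.ofReal ((‖g‖ / ‖L g‖) ^ d)
      ∂stdGaussian E = J (‖L g‖⁻¹ • L g) * ENNReal.ofReal ((‖L.symm (L g)‖ / ‖L g‖) ^ d) :=
    fun g => by
      rw [lintegral_mul_const _ (by fun_prop)]
      simp only [hJ, smul_smul, div_eq_mul_inv, L.symm_apply_apply]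
  simp_rw [hleft]
  rw [hγi _ (by fun_prop)]
  -- the change of variables `y = L x`; in polar coordinates the radial integral then cancels the
  -- factor `(‖L⁻¹ y‖ / ‖y‖) ^ d`
  have hcov : ∫⁻ x, J (‖L x‖⁻¹ • L x) * ENNReal.ofReal ((‖L.symm (L x)‖ / ‖L x‖) ^ d) * φ x =
      ∫⁻ y, J (‖y‖⁻¹ • y) * ENNReal.ofReal ((‖L.symm y‖ / ‖y‖) ^ d) * φ (L.symm y)
        ∂(Measure.map L (volume : Measure E)) := by
    rw [lintegral_map (by fun_prop) (by fun_prop)]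
    simp only [L.symm_apply_apply]
  rw [hcov, hmap, lintegral_smul_measure, lintegral_polar _ (by fun_prop), hγi G hG,
    lintegral_polar volume (f := fun x => G x * φ x) (by fun_prop), smul_eq_mul]
  have hin : ∀ u : sphere (0 : E) 1, ∫⁻ ρ : Ioi (0 : ℝ),
      J (‖ρ.1 • u.1‖⁻¹ • ρ.1 • u.1) * ENNReal.ofReal ((‖L.symm (ρ.1 • u.1)‖ / ‖ρ.1 • u.1‖) ^ d) *
        φ (L.symm (ρ.1 • u.1)) ∂κ = J u * B := fun u => by
    have hu : ‖u.1‖ = 1 := by simp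
    have hLu : 0 < ‖L.symm u.1‖ := by
      rw [norm_pos_iff, ne_eq, L.symm.map_eq_zero_iff]
      intro h
      rw [h, norm_zero] at hu
      exact zero_ne_one hu
    rw [← hBa _ hLu, ← mul_assoc, ← lintegral_const_mul _ (by fun_prop)]
    refine lintegral_congr fun ρ => ?_
    have hρ : 0 < ρ.1 := ρ.2
    simp only [hφ, map_smul, norm_smul, hu, Real.norm_eq_abs, abs_of_pos hρ, mul_one, smul_smul,
      inv_mul_cancel₀ hρ.ne', one_smul]
    rw [mul_div_cancel_left₀ _ hρ.ne']
  rw [lintegral_congr hin]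
  simp_rw [hJs]
  rw [lintegral_mul_const _ (by fun_prop), lintegral_const_mul _ (by fun_prop),
    lintegral_const_mul _ (by fun_prop)]
  ring

end Polar

/-! ### The Hartley eigenbasis of the coupling matrix -/

namespace SpinChain

section Hartley

variable (n : ℕ)

/-- The eigenvalue `λ(t) = (1 / r) ∑_{j=1}^r cos (2π t j / n)` of the coupling matrix at frequency
`t`; the frequency is a real variable so that the low frequencies can be rescaled. -/
noncomputable def eigenvalue (r : ℕ) (t : ℝ) : ℝ :=
  1 / (r : ℝ) * ∑ j ∈ Finset.Icc 1 r, Real.cos (2 * Real.pi * t * j / n)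

/-- The angle `2π k m / n` modulo `2π`. -/
noncomputable def phase (k m : ℕ) : Real.Angle := ((2 * Real.pi * k * m / n : ℝ) : Real.Angle)

theorem cos_phase (k m : ℕ) : (phase n k m).cos = Real.cos (2 * Real.pi * k * m / n) :=
  Real.Angle.cos_coe _

theorem phase_add (k a b : ℕ) : phase n k (a + b) = phase n k a + phase n k b := by
  unfold phase
  rw [← Real.Angle.coe_add]
  push_cast
  congr 1
  ring

theorem sum_cexp (t : ℝ) (ht : Complex.exp (t * Complex.I) ^ n = 1) :
    ∑ i : Fin n, Complex.exp ((i * t : ℝ) * Complex.I) =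
      if Complex.exp (t * Complex.I) = 1 then (n : ℂ) else 0 := by
  have h : ∀ i : Fin n, Complex.exp ((i * t : ℝ) * Complex.I) =
      Complex.exp (t * Complex.I) ^ (i : ℕ) := fun i => by
    rw [← Complex.exp_nat_mul]
    congr 1
    push_cast; ring
  simp_rw [h]
  rw [Fin.sum_univ_eq_sum_range fun i => Complex.exp (t * Complex.I) ^ i]
  split_ifs with h1
  · simp [h1]
  · rw [geom_sum_eq h1, ht, sub_self, zero_div]

theorem nsmul_phase_one (k m : ℕ) : m • phase n k 1 = phase n k m := by
  unfold phase
  rw [← Real.Angle.coe_nsmul]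
  congr 1
  simp; ring

theorem _root_.EuclideanSpace.real_inner_eq_sum {ι : Type*} [Fintype ι]
    (x y : EuclideanSpace ℝ ι) : inner ℝ x y = ∑ i, x i * y i := by
  simp [PiLp.inner_apply, mul_comm]

variable [NeZero n]

theorem phase_self_mul (k q : ℕ) : phase n k (n * q) = 0 := by
  unfold phase
  have hn : (n : ℝ) ≠ 0 := NeZero.ne _
  rw [Real.Angle.coe_eq_zero_iff]
  refine ⟨k * q, ?_⟩
  push_cast
  field_simp
  simp; ring

theorem phase_mod (k m : ℕ) : phase n k (m % n) = phase n k m := by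
  conv_rhs => rw [← Nat.mod_add_div m n, phase_add, phase_self_mul, add_zero]

theorem phase_fin_add (k : ℕ) (i j : Fin n) :
    phase n k (i + j : Fin n) = phase n k i + phase n k j := by
  rw [Fin.val_add, phase_mod, phase_add]

theorem phase_fin_sub (k : ℕ) (i j : Fin n) :
    phase n k (i - j : Fin n) = phase n k i - phase n k j := by
  rw [eq_sub_iff_add_eq, ← phase_fin_add, sub_add_cancel]

open Classical in
/-- Orthogonality of the characters of `ℤ / n`, stated for an angle whose `n`-th multiple
vanishes. -/
theorem sum_cos_sin_nsmul (θ : Real.Angle) (hθ : n • θ = 0) :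
    ∑ i : Fin n, ((i : ℕ) • θ).cos = (if θ = 0 then (n : ℝ) else 0) ∧
      ∑ i : Fin n, ((i : ℕ) • θ).sin = 0 := by
  induction θ using Real.Angle.induction_on with
  | _ t =>
  have hn : (n : ℝ) ≠ 0 := NeZero.ne _
  have h1 : Complex.exp (t * Complex.I) = 1 ↔ (t : Real.Angle) = 0 := by
    rw [Complex.exp_eq_one_iff, Real.Angle.coe_eq_zero_iff]
    refine exists_congr fun m => ?_
    rw [← mul_assoc, mul_left_inj' Complex.I_ne_zero, zsmul_eq_mul]
    constructor
    · intro h; exact_mod_cast h.symm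
    · intro h; exact_mod_cast h.symm
  have h2 : Complex.exp (t * Complex.I) ^ n = 1 := by
    rw [← Complex.exp_nat_mul]
    rw [← Real.Angle.coe_nsmul, Real.Angle.coe_eq_zero_iff] at hθ
    obtain ⟨m, hm⟩ := hθ
    rw [Complex.exp_eq_one_iff]
    refine ⟨m, ?_⟩
    have : ((n * t : ℝ) : ℂ) = ((m * (2 * Real.pi) : ℝ) : ℂ) := by
      rw [← zsmul_eq_mul, hm, nsmul_eq_mul]
    push_cast at this
    rw [← mul_assoc, this]; ring
  have h := sum_cexp n t h2
  simp_rw [← Real.Angle.coe_nsmul, Real.Angle.cos_coe, Real.Angle.sin_coe, nsmul_eq_mul]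
  have hre := congrArg Complex.re h
  have him := congrArg Complex.im h
  simp only [Complex.re_sum, Complex.im_sum, Complex.exp_ofReal_mul_I_re,
    Complex.exp_ofReal_mul_I_im] at hre him
  rw [hre, him]
  simp only [h1]
  constructor <;> split_ifs <;> simp

theorem phase_one_inj {k l : Fin n} (h : phase n k 1 = phase n l 1) : k = l := by
  have hn : (0 : ℝ) < n := by exact_mod_cast NeZero.pos n
  unfold phase at h
  obtain ⟨m, hm⟩ := Real.Angle.angle_eq_iff_two_pi_dvd_sub.1 h
  have hm' : (k : ℝ) - l = n * m := by
    have hp := Real.pi_pos.ne'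
    push_cast at hm
    field_simp at hm
    linarith
  have hz : ((k : ℕ) : ℤ) - (l : ℕ) = n * m := by exact_mod_cast hm'
  have := Int.eq_zero_of_abs_lt_dvd (Dvd.intro m hz.symm) (by
    rw [abs_lt]; constructor <;> have := k.2 <;> have := l.2 <;> omega)
  exact Fin.ext (by omega)

/-- The `k`-th Hartley vector `i ↦ (cos (2π k i / n) + sin (2π k i / n)) / √n`. These vectors form
a real orthonormal eigenbasis simultaneously for all symmetric circulant matrices. -/
noncomputable def hartley (k : Fin n) : EuclideanSpace ℝ (Fin n) :=
  WithLp.toLp 2 fun i => ((phase n k i).cos + (phase n k i).sin) / √(n : ℝ)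

theorem orthonormal_hartley : Orthonormal ℝ (hartley n) := by
  rw [orthonormal_iff_ite]
  intro k l
  have hn : (0 : ℝ) < n := by exact_mod_cast NeZero.pos n
  have key : ∀ i : Fin n, hartley n k i * hartley n l i =
      (((i : ℕ) • (phase n k 1 - phase n l 1)).cos +
        ((i : ℕ) • (phase n k 1 + phase n l 1)).sin) / n := fun i => by
    simp only [hartley]
    rw [smul_sub, smul_add, nsmul_phase_one, nsmul_phase_one, Real.Angle.sin_add,
      sub_eq_add_neg, Real.Angle.cos_add, Real.Angle.cos_neg, Real.Angle.sin_neg]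
    rw [div_mul_div_comm, Real.mul_self_sqrt hn.le]
    ring
  rw [EuclideanSpace.real_inner_eq_sum]
  simp_rw [key]
  have hz : ∀ k : ℕ, n • phase n k 1 = 0 := fun k => by
    rw [nsmul_phase_one]; simpa using phase_self_mul n k 1
  rw [← Finset.sum_div, Finset.sum_add_distrib,
    (sum_cos_sin_nsmul n _ (by rw [smul_sub, hz, hz, sub_zero])).1,
    (sum_cos_sin_nsmul n _ (by rw [smul_add, hz, hz, add_zero])).2, add_zero]
  by_cases hkl : k = l
  · simp [hkl, hn.ne']
  · have : phase n k 1 - phase n l 1 ≠ 0 := fun h => hkl (phase_one_inj n (sub_eq_zero.1 h))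
    simp [hkl, this]

/-- The Hartley vectors as an orthonormal basis. -/
noncomputable def hartleyBasis : OrthonormalBasis (Fin n) ℝ (EuclideanSpace ℝ (Fin n)) :=
  OrthonormalBasis.mk (orthonormal_hartley n)
    ((orthonormal_hartley n).linearIndependent.span_eq_top_of_card_eq_finrank' (by simp)).ge

theorem hartleyBasis_repr_symm_apply (y : EuclideanSpace ℝ (Fin n)) (i : Fin n) :
    (hartleyBasis n).repr.symm y i = ∑ k, y k * hartley n k i := by
  rw [← (hartleyBasis n).sum_repr_symm]
  simp [hartleyBasis]

theorem temperature_hartley (y : EuclideanSpace ℝ (Fin n)) :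
    temperature n ((hartleyBasis n).repr.symm y) = ‖y‖ ^ 2 / n := by
  rw [← (hartleyBasis n).repr.symm.norm_map y, EuclideanSpace.real_norm_sq_eq]
  rfl

theorem magnetization_hartley (y : EuclideanSpace ℝ (Fin n)) :
    magnetization n ((hartleyBasis n).repr.symm y) = √(n : ℝ) * y 0 := by
  have hn : (0 : ℝ) < √(n : ℝ) := Real.sqrt_pos.2 (by exact_mod_cast NeZero.pos n)
  have h0 : ∀ i, hartley n 0 i = 1 / √(n : ℝ) := fun i => by simp [hartley, phase]
  have h1 : y 0 = inner ℝ (hartley n 0) ((hartleyBasis n).repr.symm y) := by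
    have := (hartleyBasis n).repr_apply_apply ((hartleyBasis n).repr.symm y) 0
    rw [LinearIsometryEquiv.apply_symm_apply] at this
    rw [this]
    simp [hartleyBasis]
  rw [h1, EuclideanSpace.real_inner_eq_sum]
  simp_rw [h0]
  rw [← Finset.mul_sum]
  unfold magnetization
  field_simp

/-- The Hartley vectors diagonalize the Hamiltonian, because
`h_l(i + j) + h_l(i - j) = 2 cos (2π l j / n) h_l(i)`. -/
theorem hamiltonian_hartley (r : ℕ) (y : EuclideanSpace ℝ (Fin n)) :
    hamiltonian n r ((hartleyBasis n).repr.symm y) =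
      -(1 / 2) * ∑ k : Fin n, eigenvalue n r k * y k ^ 2 := by
  set x : EuclideanSpace ℝ (Fin n) := (hartleyBasis n).repr.symm y with hx
  have hshift : ∀ j : ℕ, ∑ i, x i * x (i + Fin.ofNat n j) =
      ∑ k : Fin n, Real.cos (2 * Real.pi * k * j / n) * y k ^ 2 := fun j => by
    set J := Fin.ofNat n j
    -- symmetrizing in `j` removes the part of the shift that is not diagonal
    have h1 : ∑ i, x i * x (i + J) = ∑ i, x i * x (i - J) := by
      rw [← (Equiv.subRight J).sum_comp]
      simp [mul_comm]
    set z : EuclideanSpace ℝ (Fin n) :=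
      WithLp.toLp 2 fun k => Real.cos (2 * Real.pi * k * j / n) * y k with hz
    have h2 : ∀ i, x (i + J) + x (i - J) = 2 * (hartleyBasis n).repr.symm z i := fun i => by
      rw [hx, hartleyBasis_repr_symm_apply, hartleyBasis_repr_symm_apply,
        hartleyBasis_repr_symm_apply, ← Finset.sum_add_distrib, Finset.mul_sum]
      refine Finset.sum_congr rfl fun k _ => ?_
      have hc : (phase n k J).cos = Real.cos (2 * Real.pi * k * j / n) := by
        rw [← cos_phase]
        change (phase n k (j % n)).cos = _
        rw [phase_mod]
      simp only [hartley, hz, ← hc]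
      rw [phase_fin_add, phase_fin_sub, sub_eq_add_neg, Real.Angle.cos_add, Real.Angle.cos_add,
        Real.Angle.sin_add, Real.Angle.sin_add, Real.Angle.cos_neg, Real.Angle.sin_neg]
      ring
    have h3 : 2 * ∑ i, x i * x (i + J) = 2 * inner ℝ x ((hartleyBasis n).repr.symm z) := by
      conv_lhs => rw [two_mul]
      nth_rw 2 [h1]
      rw [← Finset.sum_add_distrib, EuclideanSpace.real_inner_eq_sum, Finset.mul_sum]
      refine Finset.sum_congr rfl fun i _ => ?_
      rw [← mul_add, h2]
      ring
    have h4 : inner ℝ x ((hartleyBasis n).repr.symm z) = inner ℝ y z := by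
      rw [hx, LinearIsometryEquiv.inner_map_map]
    have h5 := mul_left_cancel₀ two_ne_zero h3
    rw [h5, h4, EuclideanSpace.real_inner_eq_sum]
    refine Finset.sum_congr rfl fun k _ => ?_
    simp only [hz]
    ring
  unfold hamiltonian eigenvalue
  rw [Finset.sum_comm]
  simp_rw [hshift]
  rw [Finset.sum_comm]
  simp_rw [mul_assoc, Finset.sum_mul, ← Finset.mul_sum]
  ring

end Hartley
end SpinChain

/-! ### Change of the angular law -/

namespace SpinChain

section ChangeOfLaw

variable {n : ℕ}

/-- The squared norm `∑ g_k²`. -/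
noncomputable def normSq (g : Fin n → ℝ) : ℝ := ∑ k, g k ^ 2

/-- The squared norm `∑ g_k² / b_k` of the vector with coordinates `g_k / √b_k`. -/
noncomputable def scaledNormSq (b g : Fin n → ℝ) : ℝ := ∑ k, g k ^ 2 / b k

/-- The density, up to a constant, of the angular law of the model with respect to the angular law
of the Gaussian vector with coordinates `g_k / √b_k`. It equals `exp (n ψ(p) / 2)` with
`ψ(p) = 1 - p + log p ≤ 0` and `p` the quotient of the two squared norms. -/
noncomputable def tilt (b g : Fin n → ℝ) : ℝ :=
  Real.exp (n / 2 * (1 - normSq g / scaledNormSq b g + Real.log (normSq g / scaledNormSq b g)))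

@[fun_prop]
theorem measurable_normSq : Measurable (normSq (n := n)) := by unfold normSq; fun_prop

@[fun_prop]
theorem measurable_scaledNormSq (b : Fin n → ℝ) : Measurable (scaledNormSq b) := by
  unfold scaledNormSq; fun_prop

@[fun_prop]
theorem measurable_tilt (b : Fin n → ℝ) : Measurable (tilt b) := by unfold tilt; fun_prop

theorem tilt_pos (b g : Fin n → ℝ) : 0 < tilt b g := Real.exp_pos _

theorem normSq_nonneg (g : Fin n → ℝ) : 0 ≤ normSq g := Finset.sum_nonneg fun _ _ => sq_nonneg _

theorem scaledNormSq_nonneg {b : Fin n → ℝ} (hb : ∀ k, 0 < b k) (g : Fin n → ℝ) :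
    0 ≤ scaledNormSq b g := Finset.sum_nonneg fun k _ => div_nonneg (sq_nonneg _) (hb k).le

theorem scaledNormSq_pos {b : Fin n → ℝ} (hb : ∀ k, 0 < b k) {g : Fin n → ℝ}
    (hg : 0 < normSq g) : 0 < scaledNormSq b g := by
  obtain ⟨k, -, hk⟩ := Finset.exists_ne_zero_of_sum_ne_zero hg.ne'
  have hk' : 0 < g k ^ 2 := lt_of_le_of_ne (sq_nonneg _) (Ne.symm hk)
  exact Finset.sum_pos' (fun i _ => div_nonneg (sq_nonneg _) (hb i).le)
    ⟨k, Finset.mem_univ _, div_pos hk' (hb k)⟩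

theorem tilt_le_one {b : Fin n → ℝ} (hb : ∀ k, 0 < b k) {g : Fin n → ℝ} (hg : 0 < normSq g) :
    tilt b g ≤ 1 := by
  have hp : 0 < normSq g / scaledNormSq b g := div_pos hg (scaledNormSq_pos hb hg)
  have := Real.log_le_sub_one_of_pos hp
  rw [tilt, Real.exp_le_one_iff]
  exact mul_nonpos_of_nonneg_of_nonpos (by positivity) (by linarith)

theorem normSq_pos_ae [NeZero n] : ∀ᵐ g ∂gaussianSpins n, 0 < normSq g := by
  filter_upwards [weight_pos_ae n 0] with g hg
  have hn : (0 : ℝ) < n := by exact_mod_cast NeZero.pos n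
  by_contra h
  have : ¬ 0 < temperature n g := fun h' => h ((div_pos_iff_of_pos_right hn).1 h')
  rw [weight, Set.indicator_of_notMem (by exact this)] at hg
  exact lt_irrefl _ hg

theorem norm_toLp_sq (g : Fin n → ℝ) : ‖WithLp.toLp 2 g‖ ^ 2 = normSq g :=
  EuclideanSpace.real_norm_sq_eq _

/-- Division of the `k`-th coordinate by `√b_k`. -/
noncomputable def scaling (b : Fin n → ℝ) (hb : ∀ k, 0 < b k) :
    EuclideanSpace ℝ (Fin n) ≃L[ℝ] EuclideanSpace ℝ (Fin n) :=
  ((WithLp.linearEquiv 2 ℝ (Fin n → ℝ)).trans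
    ((LinearEquiv.piCongrRight fun k => LinearEquiv.smulOfNeZero ℝ ℝ (1 / √(b k))
      (one_div_pos.2 (Real.sqrt_pos.2 (hb k))).ne').trans
    (WithLp.linearEquiv 2 ℝ (Fin n → ℝ)).symm)).toContinuousLinearEquiv

theorem scaling_apply (b : Fin n → ℝ) (hb : ∀ k, 0 < b k) (g : EuclideanSpace ℝ (Fin n))
    (k : Fin n) : scaling b hb g k = g k / √(b k) := by
  change (1 / √(b k)) * g k = _
  ring

theorem norm_scaling_sq (b : Fin n → ℝ) (hb : ∀ k, 0 < b k) (g : Fin n → ℝ) :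
    ‖scaling b hb (WithLp.toLp 2 g)‖ ^ 2 = scaledNormSq b g := by
  rw [EuclideanSpace.real_norm_sq_eq]
  refine Finset.sum_congr rfl fun k _ => ?_
  rw [scaling_apply, div_pow, Real.sq_sqrt (hb k).le]

variable [NeZero n]

theorem weight_hartley_scaling (r : ℕ) (s : ℝ) (b : Fin n → ℝ) (hb : ∀ k, 0 < b k)
    (hbs : ∀ k : Fin n, b k = s - eigenvalue n r k) {g : Fin n → ℝ} (hg : 0 < normSq g) {t : ℝ}
    (ht : t ≠ 0) :
    weight n r ((hartleyBasis n).repr.symm (t • scaling b hb (WithLp.toLp 2 g))) =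
      Real.exp (n / 2 * (s - normSq g / scaledNormSq b g)) := by
  have hn : (0 : ℝ) < n := by exact_mod_cast NeZero.pos n
  have hV := scaledNormSq_pos hb hg
  have hT : temperature n ((hartleyBasis n).repr.symm (t • scaling b hb (WithLp.toLp 2 g))) =
      t ^ 2 * scaledNormSq b g / n := by
    rw [temperature_hartley, norm_smul, mul_pow, norm_scaling_sq, Real.norm_eq_abs, sq_abs]
  have hH : hamiltonian n r ((hartleyBasis n).repr.symm (t • scaling b hb (WithLp.toLp 2 g))) =
      -(1 / 2) * (t ^ 2 * (s * scaledNormSq b g - normSq g)) := by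
    rw [hamiltonian_hartley]
    congr 1
    rw [scaledNormSq, normSq, Finset.mul_sum, ← Finset.sum_sub_distrib, Finset.mul_sum]
    refine Finset.sum_congr rfl fun k _ => ?_
    have he : eigenvalue n r k = s - b k := by rw [hbs]; ring
    have hbk := (hb k).ne'
    rw [PiLp.smul_apply, scaling_apply, smul_eq_mul, mul_pow, div_pow, Real.sq_sqrt (hb k).le, he]
    field_simp
  rw [weight, Set.indicator_of_mem (by
    change 0 < temperature n _; rw [hT]; positivity), hT, hH]
  congr 1
  field_simp

/-- The law of the magnetization is, up to a constant, the law of an explicit function of two independent standard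
Gaussian vectors, reweighted by the tilt. -/
theorem exists_map_magnetization_eq (r : ℕ) (s : ℝ) (b : Fin n → ℝ) (hb : ∀ k, 0 < b k)
    (hbs : ∀ k : Fin n, b k = s - eigenvalue n r k) :
    ∃ c : ℝ≥0∞, (spinLaw n r).map (magnetization n) =
      c • (((gaussianSpins n).prod (gaussianSpins n)).withDensity
        fun p => ENNReal.ofReal (tilt b p.1)).map
          fun p => √(normSq p.2) / √(scaledNormSq b p.1) * (√(n : ℝ) * (p.1 0 / √(b 0))) := by
  have hn : (0 : ℝ) < n := by exact_mod_cast NeZero.pos n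
  have : Nontrivial (EuclideanSpace ℝ (Fin n)) := by
    have : Nonempty (Fin n) := ⟨0⟩
    infer_instance
  set L := (scaling b hb).trans (hartleyBasis n).repr.symm.toContinuousLinearEquiv
  obtain ⟨C, hC0, hC, hCG⟩ := exists_lintegral_stdGaussian_radial_angular L
  have hLa : ∀ g, L g = (hartleyBasis n).repr.symm (scaling b hb g) := fun g => rfl
  have hLn : ∀ g : Fin n → ℝ, ‖L (WithLp.toLp 2 g)‖ = √(scaledNormSq b g) := fun g => by
    rw [hLa, LinearIsometryEquiv.norm_map, ← norm_scaling_sq b hb, Real.sqrt_sq (norm_nonneg _)]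
  have hgn : ∀ g : Fin n → ℝ, ‖WithLp.toLp 2 g‖ = √(normSq g) := fun g => by
    rw [← norm_toLp_sq, Real.sqrt_sq (norm_nonneg _)]
  have hSm : Measurable (magnetization n) := by unfold magnetization; fun_prop
  have hwm := measurable_weight n r
  set a : ℝ≥0∞ := ENNReal.ofReal (Real.exp (n / 2 * (s - 1))) with ha
  set Z : ℝ≥0∞ := ENNReal.ofReal (1 / partitionFunction n r) with hZ
  refine ⟨Z * C⁻¹ * a, Measure.ext_of_lintegral _ fun f hf => ?_⟩
  rw [lintegral_map hf hSm, lintegral_smul_measure, lintegral_map hf (by fun_prop),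
    lintegral_withDensity_eq_lintegral_mul _ (by fun_prop) (by fun_prop),
    lintegral_prod _ (by fun_prop), spinLaw,
    lintegral_withDensity_eq_lintegral_mul _ (by fun_prop) (by fun_prop)]
  have hG := hCG (fun x => ENNReal.ofReal (weight n r x) * f (magnetization n x)) (by fun_prop)
  rw [← map_pi_eq_stdGaussian] at hG
  change ∫⁻ g, ∫⁻ z, _ ∂((gaussianSpins n).map _) ∂((gaussianSpins n).map _) =
    C * ∫⁻ x, _ ∂((gaussianSpins n).map _) at hG
  rw [lintegral_map (by fun_prop) (by fun_prop), lintegral_map (by fun_prop) (by fun_prop)] at hG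
  have hin : ∀ᵐ g ∂gaussianSpins n, ∫⁻ z, ENNReal.ofReal (weight n r
        ((‖z‖ / ‖L (WithLp.toLp 2 g)‖) • L (WithLp.toLp 2 g)).ofLp) *
        f (magnetization n ((‖z‖ / ‖L (WithLp.toLp 2 g)‖) • L (WithLp.toLp 2 g)).ofLp) *
        ENNReal.ofReal ((‖WithLp.toLp 2 g‖ / ‖L (WithLp.toLp 2 g)‖) ^
          Module.finrank ℝ (EuclideanSpace ℝ (Fin n)))
        ∂((gaussianSpins n).map (WithLp.toLp 2)) =
      a * ∫⁻ z, ENNReal.ofReal (tilt b g) * f (√(normSq z) / √(scaledNormSq b g) *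
        (√(n : ℝ) * (g 0 / √(b 0)))) ∂gaussianSpins n := by
    filter_upwards [normSq_pos_ae] with g hg
    have hV := scaledNormSq_pos hb hg
    rw [lintegral_map (by fun_prop) (by fun_prop), ← lintegral_const_mul _ (by fun_prop)]
    refine lintegral_congr_ae ?_
    filter_upwards [normSq_pos_ae] with z hz
    rw [hgn z, hgn g, hLn, hLa, ← map_smul, weight_hartley_scaling r s b hb hbs hg (by positivity),
      magnetization_hartley, PiLp.smul_apply, scaling_apply, finrank_euclideanSpace_fin,
      mul_right_comm, ← mul_assoc, ha, ← ENNReal.ofReal_mul (by positivity),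
      ← ENNReal.ofReal_mul (by positivity), tilt, ← Real.sqrt_div hg.le]
    have e1 : √(normSq g / scaledNormSq b g) ^ n =
        Real.exp (n / 2 * Real.log (normSq g / scaledNormSq b g)) := by
      rw [Real.sqrt_eq_rpow, ← Real.rpow_mul_natCast (by positivity),
        Real.rpow_def_of_pos (by positivity)]
      congr 1; ring
    rw [e1, ← Real.exp_add, ← Real.exp_add, smul_eq_mul]
    congr 2
    · congr 1; ring
    · simp only; ring
  rw [lintegral_congr_ae hin, lintegral_const_mul _ (by fun_prop)] at hG
  have h1 : ∫⁻ x, ((fun x => ENNReal.ofReal (1 / partitionFunction n r * weight n r x)) *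
      fun x => f (magnetization n x)) x ∂gaussianSpins n =
      Z * ∫⁻ x, ENNReal.ofReal (weight n r x) * f (magnetization n x) ∂gaussianSpins n := by
    rw [← lintegral_const_mul _ (by fun_prop)]
    refine lintegral_congr fun x => ?_
    rw [Pi.mul_apply, hZ, ENNReal.ofReal_mul (one_div_pos.2 (partitionFunction_pos n r)).le,
      mul_assoc]
  rw [h1, smul_eq_mul, mul_assoc (Z * C⁻¹) a]
  change _ = Z * C⁻¹ * (a * ∫⁻ g, ∫⁻ z, _ ∂gaussianSpins n ∂gaussianSpins n)
  simp only [Pi.mul_apply]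
  rw [hG, mul_assoc, ← mul_assoc C⁻¹, ENNReal.inv_mul_cancel hC0 hC, one_mul]

/-- The normalized form of `exists_map_magnetization_eq`. -/
theorem integral_magnetization_spinLaw (r : ℕ) (s : ℝ) (b : Fin n → ℝ) (hb : ∀ k, 0 < b k)
    (hbs : ∀ k : Fin n, b k = s - eigenvalue n r k) {f : ℝ → ℝ} (hf : Measurable f) :
    (∫ x, f (magnetization n x) ∂spinLaw n r) * ∫ g, tilt b g ∂gaussianSpins n =
      ∫ p, f (√(normSq p.2) / √(scaledNormSq b p.1) * (√(n : ℝ) * (p.1 0 / √(b 0)))) * tilt b p.1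
        ∂(gaussianSpins n).prod (gaussianSpins n) := by
  have hSm : Measurable (magnetization n) := by unfold magnetization; fun_prop
  obtain ⟨c, hc⟩ := exists_map_magnetization_eq r s b hb hbs
  have key : ∀ f : ℝ → ℝ, Measurable f → ∫ x, f (magnetization n x) ∂spinLaw n r =
      c.toReal * ∫ p, f (√(normSq p.2) / √(scaledNormSq b p.1) * (√(n : ℝ) * (p.1 0 / √(b 0)))) *
        tilt b p.1 ∂(gaussianSpins n).prod (gaussianSpins n) := fun f hf => by
    rw [← integral_map (φ := magnetization n) hSm.aemeasurable
      hf.aestronglyMeasurable, hc, integral_smul_measure,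
      integral_map (by fun_prop) hf.aestronglyMeasurable,
      integral_withDensity_eq_integral_toReal_smul (by fun_prop) (by simp), smul_eq_mul]
    congr 1
    refine integral_congr_ae (Eventually.of_forall fun p => ?_)
    simp only [smul_eq_mul]
    rw [ENNReal.toReal_ofReal (tilt_pos _ _).le, mul_comm]
  have h1 := key (fun _ => 1) measurable_const
  simp only [one_mul, integral_const, smul_eq_mul, mul_one, probReal_univ] at h1
  have h2 := integral_fun_fst (μ := gaussianSpins n) (ν := gaussianSpins n) (tilt b)
  rw [probReal_univ, one_smul] at h2
  rw [key f hf, ← h2, mul_right_comm, ← h1, one_mul]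

end ChangeOfLaw
end SpinChain

/-! ### Estimates for the eigenvalues -/

namespace SpinChain

section Eigenvalues

variable {n r : ℕ}

theorem eigenvalue_zero (n : ℕ) (hr : r ≠ 0) : eigenvalue n r 0 = 1 := by
  have : (r : ℝ) ≠ 0 := by exact_mod_cast hr
  simp [eigenvalue, this]

theorem eigenvalue_le_one (n r : ℕ) (t : ℝ) : eigenvalue n r t ≤ 1 := by
  rcases Nat.eq_zero_or_pos r with rfl | hr
  · simp [eigenvalue]
  have hr' : (0 : ℝ) < r := by exact_mod_cast hr
  rw [eigenvalue, one_div_mul_eq_div, div_le_one hr']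
  calc _ ≤ ∑ j ∈ Finset.Icc 1 r, (1 : ℝ) := Finset.sum_le_sum fun _ _ => Real.cos_le_one _
    _ = r := by simp

theorem neg_one_le_eigenvalue (n r : ℕ) (t : ℝ) : -1 ≤ eigenvalue n r t := by
  rcases Nat.eq_zero_or_pos r with rfl | hr
  · simp [eigenvalue]
  have hr' : (0 : ℝ) < r := by exact_mod_cast hr
  rw [eigenvalue, one_div_mul_eq_div, le_div_iff₀ hr']
  calc -1 * (r : ℝ) = ∑ j ∈ Finset.Icc 1 r, (-1 : ℝ) := by simp
    _ ≤ _ := Finset.sum_le_sum fun _ _ => Real.neg_one_le_cos _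

theorem eigenvalue_sq_le_one (n r : ℕ) (t : ℝ) : eigenvalue n r t ^ 2 ≤ 1 := by
  have h1 := eigenvalue_le_one n r t
  have h2 := neg_one_le_eigenvalue n r t
  nlinarith

theorem eigenvalue_add_period (hn : n ≠ 0) (t : ℝ) :
    eigenvalue n r (t + n) = eigenvalue n r t := by
  have hn' : (n : ℝ) ≠ 0 := by exact_mod_cast hn
  unfold eigenvalue
  congr 1
  refine Finset.sum_congr rfl fun j _ => ?_
  rw [show 2 * Real.pi * (t + n) * j / n = 2 * Real.pi * t * j / n + (j : ℕ) * (2 * Real.pi) by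
    field_simp, Real.cos_add_nat_mul_two_pi]

theorem sum_eigenvalue [NeZero n] (hrn : r < n) : ∑ k : Fin n, eigenvalue n r k = 0 := by
  unfold eigenvalue
  rw [← Finset.mul_sum, Finset.sum_comm, Finset.sum_eq_zero, mul_zero]
  intro j hj
  obtain ⟨hj1, hj2⟩ := Finset.mem_Icc.1 hj
  have hz : n • phase n j 1 = 0 := by
    rw [nsmul_phase_one]; simpa using phase_self_mul n j 1
  have h := (sum_cos_sin_nsmul n (phase n j 1) hz).1
  have hne : phase n j 1 ≠ 0 := fun h0 => by
    have h1 : phase n (⟨j, by omega⟩ : Fin n) 1 = phase n (0 : Fin n) 1 := by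
      simpa [phase] using h0
    have := congrArg Fin.val (phase_one_inj n h1)
    simp at this
    omega
  rw [if_neg hne] at h
  rw [← h]
  refine Finset.sum_congr rfl fun k _ => ?_
  rw [nsmul_phase_one, cos_phase]
  congr 1
  ring

theorem two_mul_sin_mul_sum_cos (θ : ℝ) (r : ℕ) :
    2 * Real.sin (θ / 2) * ∑ j ∈ Finset.Icc 1 r, Real.cos (θ * j) =
      Real.sin (θ * (r + 1 / 2)) - Real.sin (θ / 2) := by
  induction r with
  | zero => simp; ring_nf
  | succ m ih =>
    rw [Finset.sum_Icc_succ_top (by omega), mul_add, ih]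
    have h1 : θ * ((m + 1 : ℕ) + 1 / 2) = θ * (m + 1 : ℕ) + θ / 2 := by ring
    have h2 : θ * (m + 1 / 2) = θ * (m + 1 : ℕ) - θ / 2 := by push_cast; ring
    rw [h1, h2, Real.sin_add, Real.sin_sub]
    ring

theorem eigenvalue_eq (n r : ℕ) (t : ℝ) : eigenvalue n r t =
    1 / r * ∑ j ∈ Finset.Icc 1 r, Real.cos (2 * Real.pi * t / n * j) := by
  unfold eigenvalue
  congr 1
  refine Finset.sum_congr rfl fun j _ => ?_
  congr 1
  ring

/-- Decay at high frequency, from the closed form of the Dirichlet kernel. -/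
theorem abs_eigenvalue_mul_le (hn : n ≠ 0) (hr : r ≠ 0) {t : ℝ} (ht : |t| ≤ n / 2) :
    |eigenvalue n r t| * (2 * |t * r / n|) ≤ 1 := by
  have hn' : (0 : ℝ) < n := by positivity
  have hr' : (0 : ℝ) < r := by positivity
  set θ := 2 * Real.pi * t / n with hθ
  set σ := ∑ j ∈ Finset.Icc 1 r, Real.cos (θ * j) with hσ
  have hsin : 2 * |t| / n ≤ |Real.sin (θ / 2)| := by
    have h2 : |θ / 2| = Real.pi * |t| / n := by
      rw [hθ, show 2 * Real.pi * t / n / 2 = Real.pi * t / n by ring, abs_div, abs_mul,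
        abs_of_pos Real.pi_pos, abs_of_pos hn']
    have h3 := Real.mul_abs_le_abs_sin (x := θ / 2) (by
      rw [h2, div_le_div_iff₀ hn' two_pos]
      have := mul_le_mul_of_nonneg_left ht Real.pi_pos.le
      linarith)
    rw [h2] at h3
    have := Real.pi_pos.ne'
    calc 2 * |t| / n = 2 / Real.pi * (Real.pi * |t| / n) := by field_simp
      _ ≤ _ := h3
  have h1 : |2 * Real.sin (θ / 2) * σ| ≤ 2 := by
    rw [hσ, two_mul_sin_mul_sum_cos]
    refine (abs_sub _ _).trans ?_
    linarith [Real.abs_sin_le_one (θ * (r + 1 / 2)), Real.abs_sin_le_one (θ / 2)]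
  rw [abs_mul, abs_mul, abs_two] at h1
  rw [eigenvalue_eq, abs_mul, abs_of_pos (by positivity : (0 : ℝ) < 1 / r), abs_div, abs_mul,
    abs_of_pos hr', abs_of_pos hn']
  have h4 : 2 * |t| / n * |σ| ≤ |Real.sin (θ / 2)| * |σ| :=
    mul_le_mul_of_nonneg_right hsin (abs_nonneg _)
  calc 1 / (r : ℝ) * |σ| * (2 * (|t| * r / n)) = 2 * |t| / n * |σ| := by field_simp
    _ ≤ 1 := by linarith

theorem cube_div_three_le_sum_sq (m : ℕ) :
    (m : ℝ) ^ 3 / 3 ≤ ∑ j ∈ Finset.Icc 1 m, (j : ℝ) ^ 2 := by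
  induction m with
  | zero => simp
  | succ m ih =>
    rw [Finset.sum_Icc_succ_top (by omega)]
    have : (0 : ℝ) ≤ m := m.cast_nonneg
    push_cast
    nlinarith

theorem sum_sq_Icc (m : ℕ) :
    ∑ j ∈ Finset.Icc 1 m, (j : ℝ) ^ 2 = m * (m + 1) * (2 * m + 1) / 6 := by
  induction m with
  | zero => simp
  | succ m ih =>
    rw [Finset.sum_Icc_succ_top (by omega), ih]
    push_cast
    ring

theorem one_sub_eigenvalue (n : ℕ) (hr : r ≠ 0) (t : ℝ) : 1 - eigenvalue n r t =
    1 / r * ∑ j ∈ Finset.Icc 1 r, (1 - Real.cos (2 * Real.pi * t / n * j)) := by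
  have hr' : (r : ℝ) ≠ 0 := by exact_mod_cast hr
  rw [eigenvalue_eq, Finset.sum_sub_distrib, mul_sub]
  simp [hr']

/-- Quadratic lower bound for the spectral gap at low frequency. Only the indices `j ≤ r / 2` are
used, for which the angles stay in `[-π, π]`. -/
theorem sq_le_one_sub_eigenvalue (hn : n ≠ 0) (hr : 2 ≤ r) {t : ℝ} (ht : |t * r / n| ≤ 1) :
    8 / 81 * (t * r / n) ^ 2 ≤ 1 - eigenvalue n r t := by
  have hn' : (0 : ℝ) < n := by positivity
  have hr' : (0 : ℝ) < r := by positivity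
  have hπ := Real.pi_pos
  rw [one_sub_eigenvalue n (by omega)]
  set θ := 2 * Real.pi * t / n with hθ
  set m := r / 2 with hm
  have hm3 : (r : ℝ) / 3 ≤ m := by
    rw [div_le_iff₀ three_pos]
    have : r ≤ m * 3 := by omega
    exact_mod_cast this
  have hm2 : 2 * (m : ℝ) ≤ r := by
    have : 2 * m ≤ r := by omega
    exact_mod_cast this
  have hθm : |θ| * m ≤ Real.pi := by
    have h1 : |θ| * r = 2 * Real.pi * |t * r / n| := by
      rw [hθ, abs_div, abs_div, abs_mul, abs_mul, abs_mul, abs_two, abs_of_pos hπ,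
        abs_of_pos hr', abs_of_pos hn']
      ring
    have h2 : |θ| * r ≤ 2 * Real.pi := by
      rw [h1]; nlinarith
    nlinarith [abs_nonneg θ]
  have h1 : ∑ j ∈ Finset.Icc 1 m, 2 / Real.pi ^ 2 * (θ * j) ^ 2 ≤
      ∑ j ∈ Finset.Icc 1 r, (1 - Real.cos (θ * j)) := by
    calc _ ≤ ∑ j ∈ Finset.Icc 1 m, (1 - Real.cos (θ * j)) := by
          refine Finset.sum_le_sum fun j hj => ?_
          have hj' : (j : ℝ) ≤ m := by exact_mod_cast (Finset.mem_Icc.1 hj).2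
          have := Real.cos_le_one_sub_mul_cos_sq (x := θ * j) (by
            rw [abs_mul, Nat.abs_cast]
            exact (mul_le_mul_of_nonneg_left hj' (abs_nonneg _)).trans hθm)
          linarith
      _ ≤ _ := Finset.sum_le_sum_of_subset_of_nonneg
          (Finset.Icc_subset_Icc_right (by omega))
          fun j _ _ => sub_nonneg.2 (Real.cos_le_one _)
  have h2 : 2 / Real.pi ^ 2 * θ ^ 2 * ((r : ℝ) ^ 3 / 81) ≤
      ∑ j ∈ Finset.Icc 1 m, 2 / Real.pi ^ 2 * (θ * j) ^ 2 := by
    simp_rw [mul_pow, ← mul_assoc]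
    rw [← Finset.mul_sum]
    refine mul_le_mul_of_nonneg_left ?_ (by positivity)
    refine le_trans ?_ (cube_div_three_le_sum_sq m)
    have : ((r : ℝ) / 3) ^ 3 ≤ (m : ℝ) ^ 3 := pow_le_pow_left₀ (by positivity) hm3 3
    linarith [show ((r : ℝ) / 3) ^ 3 = (r : ℝ) ^ 3 / 27 by ring]
  calc 8 / 81 * (t * r / n) ^ 2 = 1 / r * (2 / Real.pi ^ 2 * θ ^ 2 * ((r : ℝ) ^ 3 / 81)) := by
        rw [hθ]; field_simp; ring
    _ ≤ _ := mul_le_mul_of_nonneg_left (h2.trans h1) (by positivity)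

/-- Second order expansion of the spectral gap at low frequency. -/
theorem abs_one_sub_eigenvalue_sub_le (hr : r ≠ 0) {t : ℝ} (ht : |2 * Real.pi * t / n| * r ≤ 1) :
    |1 - eigenvalue n r t - (2 * Real.pi * t / n) ^ 2 * ((r + 1) * (2 * r + 1) / 12)| ≤
      ((2 * Real.pi * t / n) * r) ^ 4 := by
  have hr' : (0 : ℝ) < r := by positivity
  set θ := 2 * Real.pi * t / n with hθ
  have h1 : 1 - eigenvalue n r t - θ ^ 2 * ((r + 1) * (2 * r + 1) / 12) =
      1 / r * ∑ j ∈ Finset.Icc 1 r, (1 - Real.cos (θ * j) - (θ * j) ^ 2 / 2) := by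
    have h0 : ∑ j ∈ Finset.Icc 1 r, (θ * j) ^ 2 / 2 =
        θ ^ 2 / 2 * (r * (r + 1) * (2 * r + 1) / 6) := by
      rw [← sum_sq_Icc, Finset.mul_sum]
      exact Finset.sum_congr rfl fun j _ => by ring
    rw [one_sub_eigenvalue n hr, Finset.sum_sub_distrib (f := fun j : ℕ => 1 - Real.cos (θ * j)),
      h0, mul_sub]
    congr 1
    field_simp
    ring
  rw [h1, abs_mul, abs_of_pos (by positivity : (0 : ℝ) < 1 / r), one_div_mul_eq_div,
    div_le_iff₀ hr']
  calc _ ≤ ∑ j ∈ Finset.Icc 1 r, |1 - Real.cos (θ * j) - (θ * j) ^ 2 / 2| :=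
        Finset.abs_sum_le_sum_abs _ _
    _ ≤ ∑ j ∈ Finset.Icc 1 r, (θ * r) ^ 4 := by
        refine Finset.sum_le_sum fun j hj => ?_
        have hj' : (j : ℝ) ≤ r := by exact_mod_cast (Finset.mem_Icc.1 hj).2
        have h3 : |θ * j| ≤ |θ| * r := by
          rw [abs_mul, Nat.abs_cast]
          exact mul_le_mul_of_nonneg_left hj' (abs_nonneg _)
        have h4 := Real.cos_bound (h3.trans ht)
        have h5 : |θ * j| ^ 4 ≤ (|θ| * r) ^ 4 := pow_le_pow_left₀ (abs_nonneg _) h3 4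
        have h6 : (|θ| * r) ^ 4 = (θ * r) ^ 4 := by
          rw [mul_pow, mul_pow, Even.pow_abs (by decide)]
        have h7 : 0 ≤ |θ * j| ^ 4 := by positivity
        rw [show 1 - Real.cos (θ * j) - (θ * j) ^ 2 / 2 =
          -(Real.cos (θ * j) - (1 - (θ * j) ^ 2 / 2)) by ring, abs_neg]
        linarith
    _ = _ := by simp [mul_comm]

end Eigenvalues
end SpinChain

/-! ### The resolvent trace and its Riemann sum -/

namespace SpinChain

section Resolvent

variable {n r : ℕ}

/-- The trace `∑_k 1 / (1 + ε - λ_k)` of the resolvent of the coupling matrix. -/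
noncomputable def resolventTrace (n r : ℕ) (ε : ℝ) : ℝ :=
  ∑ k : Fin n, 1 / (1 + ε - eigenvalue n r k)

theorem resolvent_denom_pos {ε : ℝ} (hε : 0 < ε) (t : ℝ) : 0 < 1 + ε - eigenvalue n r t := by
  linarith [eigenvalue_le_one n r t]

theorem resolventTrace_antitone {ε₁ ε₂ : ℝ} (h1 : 0 < ε₁) (h : ε₁ ≤ ε₂) :
    resolventTrace n r ε₂ ≤ resolventTrace n r ε₁ :=
  Finset.sum_le_sum fun k _ =>
    one_div_le_one_div_of_le (resolvent_denom_pos h1 k) (by linarith)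

/-- Existence of the saddle point. The eigenvalue `1` of frequency `0` gives a trace at least `n` at
`ε = 1 / n`, and all summands are at most `1` at `ε = 1`. -/
theorem exists_resolventTrace_eq [NeZero n] (hr : r ≠ 0) :
    ∃ ε : ℝ, 0 < ε ∧ ε ≤ 1 ∧ resolventTrace n r ε = n := by
  have hn : (0 : ℝ) < n := by exact_mod_cast NeZero.pos n
  have hn1 : (1 : ℝ) ≤ n := by exact_mod_cast NeZero.pos n
  have h01 : 1 / (n : ℝ) ≤ 1 := by rw [div_le_one hn]; exact hn1
  have hpos : ∀ x ∈ Set.Icc (1 / (n : ℝ)) 1, 0 < x := fun x hx =>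
    lt_of_lt_of_le (by positivity) hx.1
  have hcont : ContinuousOn (resolventTrace n r) (Set.Icc (1 / (n : ℝ)) 1) := by
    unfold resolventTrace
    refine continuousOn_finsetSum _ fun k _ => ?_
    refine ContinuousOn.div continuousOn_const (by fun_prop) fun x hx => ?_
    exact (resolvent_denom_pos (hpos x hx) _).ne'
  have hlow : resolventTrace n r 1 ≤ n := by
    calc _ ≤ ∑ k : Fin n, (1 : ℝ) := Finset.sum_le_sum fun k _ => by
          have := eigenvalue_le_one n r k
          rw [div_le_one (by linarith)]
          linarith
      _ = n := by simp
  have hhigh : (n : ℝ) ≤ resolventTrace n r (1 / n) := by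
    have h0 : (n : ℝ) = 1 / (1 + 1 / n - eigenvalue n r ((0 : Fin n) : ℕ)) := by
      simp [eigenvalue_zero n hr]
    conv_lhs => rw [h0]
    exact Finset.single_le_sum (f := fun k : Fin n => 1 / (1 + 1 / (n : ℝ) - eigenvalue n r k))
      (fun k _ => one_div_nonneg.2 (resolvent_denom_pos (by positivity) _).le) (Finset.mem_univ 0)
  obtain ⟨ε, hε, h⟩ := intermediate_value_Icc' h01 hcont ⟨hlow, hhigh⟩
  exact ⟨ε, hpos ε hε, hε.2, h⟩

/-- Since the coupling matrix has trace zero, only the second order part of the resolvent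
contributes to the deviation of its trace from `n / (1 + ε)`. -/
theorem resolventTrace_eq [NeZero n] (hrn : r < n) {ε : ℝ} (hε : 0 < ε) :
    resolventTrace n r ε = n / (1 + ε) + 1 / (1 + ε) ^ 2 *
      ∑ k : Fin n, eigenvalue n r k ^ 2 / (1 + ε - eigenvalue n r k) := by
  have h : ∀ k : Fin n, 1 / (1 + ε - eigenvalue n r k) = 1 / (1 + ε) +
      1 / (1 + ε) ^ 2 * eigenvalue n r k +
      1 / (1 + ε) ^ 2 * (eigenvalue n r k ^ 2 / (1 + ε - eigenvalue n r k)) := fun k => by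
    have h1 := (resolvent_denom_pos (n := n) (r := r) hε k).ne'
    have h2 : 1 + ε ≠ 0 := by positivity
    field_simp
    ring
  unfold resolventTrace
  rw [Finset.sum_congr rfl fun k _ => h k, Finset.sum_add_distrib, Finset.sum_add_distrib,
    ← Finset.mul_sum, ← Finset.mul_sum, sum_eigenvalue hrn]
  simp [div_eq_mul_inv]

/-- At the saddle point the variance of `∑ g_k² / (1 + ε - λ_k)` is `O(n)`. -/
theorem sum_resolvent_sq_le [NeZero n] (hrn : r < n) {ε : ℝ} (hε : 0 < ε)
    (h : resolventTrace n r ε = n) :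
    ∑ k : Fin n, (1 / (1 + ε - eigenvalue n r k)) ^ 2 ≤ 4 * (n : ℝ) := by
  have hn : (0 : ℝ) ≤ n := n.cast_nonneg
  have hs : 0 < 1 + ε := by positivity
  set Q := ∑ k : Fin n, eigenvalue n r k ^ 2 / (1 + ε - eigenvalue n r k) with hQ
  have hQv : Q = (1 + ε) * n * ε := by
    have := resolventTrace_eq hrn hε
    rw [h, ← hQ] at this
    field_simp at this
    linarith
  have hk : ∀ k : Fin n, (1 / (1 + ε - eigenvalue n r k)) ^ 2 ≤ 2 / (1 + ε) ^ 2 +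
      2 / ((1 + ε) ^ 2 * ε) * (eigenvalue n r k ^ 2 / (1 + ε - eigenvalue n r k)) := fun k => by
    set d := 1 + ε - eigenvalue n r k with hd
    have hd0 : 0 < d := resolvent_denom_pos hε _
    have hdε : ε ≤ d := by linarith [eigenvalue_le_one n r k]
    set v := eigenvalue n r k with hv
    have h1 : 1 / d = 1 / (1 + ε) + v / ((1 + ε) * d) := by
      field_simp
      rw [hd]; ring
    have h2 : (v / ((1 + ε) * d)) ^ 2 ≤ 1 / ((1 + ε) ^ 2 * ε) * (v ^ 2 / d) := by
      rw [div_pow, mul_pow, div_mul_div_comm, one_mul]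
      refine div_le_div_of_nonneg_left (sq_nonneg _) (by positivity) ?_
      rw [mul_assoc]
      refine mul_le_mul_of_nonneg_left ?_ (by positivity)
      nlinarith
    rw [h1]
    have h3 := sq_nonneg (1 / (1 + ε) - v / ((1 + ε) * d))
    have h4 : (2 : ℝ) / (1 + ε) ^ 2 = 2 * (1 / (1 + ε)) ^ 2 := by rw [div_pow]; ring
    have h5 : 2 / ((1 + ε) ^ 2 * ε) * (v ^ 2 / d) = 2 * (1 / ((1 + ε) ^ 2 * ε) * (v ^ 2 / d)) := by
      ring
    rw [h4, h5]
    nlinarith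
  refine (Finset.sum_le_sum fun k _ => hk k).trans ?_
  rw [Finset.sum_add_distrib, ← Finset.mul_sum, ← hQ, hQv]
  simp only [Finset.sum_const, Finset.card_univ, Fintype.card_fin, nsmul_eq_mul]
  have h1 : 2 / ((1 + ε) ^ 2 * ε) * ((1 + ε) * n * ε) = 2 * n / (1 + ε) := by field_simp
  have h2 : 2 * (n : ℝ) / (1 + ε) ≤ 2 * n := div_le_self (by positivity) (by linarith)
  have h3 : (2 : ℝ) / (1 + ε) ^ 2 ≤ 2 := div_le_self (by positivity) (by nlinarith)
  rw [h1]
  nlinarith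

end Resolvent

section RiemannSum

/-- A sum over a period, with the frequencies represented by integers near `0`. -/
theorem sum_fin_eq_sum_Ico {n : ℕ} {f : ℝ → ℝ} (hf : ∀ t, f (t + n) = f t) {m : ℕ} (hm : m ≤ n) :
    ∑ k : Fin n, f k = ∑ k ∈ Finset.Ico (-(m : ℤ)) (n - m), f k := by
  rw [Fin.sum_univ_eq_sum_range fun k => f k]
  refine Finset.sum_nbij' (fun k : ℕ => if k + m < n then (k : ℤ) else k - n)
    (fun k : ℤ => if 0 ≤ k then k.toNat else (k + n).toNat) ?_ ?_ ?_ ?_ ?_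
  · intro k hk
    rw [Finset.mem_range] at hk
    rw [Finset.mem_Ico]
    split_ifs <;> omega
  · intro k hk
    rw [Finset.mem_Ico] at hk
    rw [Finset.mem_range]
    split_ifs <;> omega
  · intro k hk
    rw [Finset.mem_range] at hk
    split_ifs <;> omega
  · intro k hk
    rw [Finset.mem_Ico] at hk
    split_ifs <;> omega
  · intro k _
    split_ifs
    · simp
    · simpa using hf (k - n)

theorem integral_floor_step {h : ℝ} (hh : 0 < h) (S : Finset ℤ) (f : ℤ → ℝ) :
    ∫ τ : ℝ, (if ⌊τ / h⌋ ∈ S then f ⌊τ / h⌋ else 0) = h * ∑ k ∈ S, f k := by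
  have hfl : ∀ (τ : ℝ) (k : ℤ), τ ∈ Set.Ico (k * h) ((k + 1) * h) ↔ ⌊τ / h⌋ = k := fun τ k => by
    rw [Int.floor_eq_iff, le_div_iff₀ hh, div_lt_iff₀ hh, Set.mem_Ico]
  have h1 : ∀ τ : ℝ, (if ⌊τ / h⌋ ∈ S then f ⌊τ / h⌋ else 0) =
      ∑ k ∈ S, (Set.Ico (k * h) ((k + 1) * h)).indicator (fun _ => f k) τ := fun τ => by
    simp only [Set.indicator_apply, hfl]
    rw [Finset.sum_ite_eq]
  simp_rw [h1]
  rw [integral_finsetSum _ fun k _ => ?_, Finset.mul_sum]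
  · refine Finset.sum_congr rfl fun k _ => ?_
    rw [integral_indicator_const _ measurableSet_Ico, Real.volume_real_Ico,
      show ((k : ℝ) + 1) * h - k * h = h by ring, max_eq_left hh.le, smul_eq_mul]
  · rw [integrable_indicator_iff measurableSet_Ico]
    exact integrableOn_const (by simp)

theorem integral_inv_add_mul_sq {a c : ℝ} (ha : 0 < a) (hc : 0 < c) :
    ∫ x : ℝ, 1 / (a + c * x ^ 2) = Real.pi / √(a * c) := by
  have h : ∀ x : ℝ, 1 / (a + c * x ^ 2) = 1 / a * (1 + (√(c / a) * x) ^ 2)⁻¹ := fun x => by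
    rw [mul_pow, Real.sq_sqrt (by positivity)]
    field_simp
  simp_rw [h]
  rw [integral_const_mul, Measure.integral_comp_mul_left (fun x : ℝ => (1 + x ^ 2)⁻¹),
    integral_univ_inv_one_add_sq, smul_eq_mul, abs_of_nonneg (by positivity), ← Real.sqrt_inv,
    inv_div]
  have h2 : √(a / c) = a / √(a * c) := by
    rw [Real.sqrt_eq_iff_mul_self_eq (by positivity) (by positivity), div_mul_div_comm,
      Real.mul_self_sqrt (by positivity)]
    field_simp
  rw [h2]
  field_simp

/-- The rescaled summand is dominated uniformly by an integrable function of the rescaled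
frequency. Here `ρ = r ^ (2 / 3)`. -/
theorem summand_le {n r : ℕ} {ρ a t : ℝ} (hn : n ≠ 0) (hr : 2 ≤ r) (hρ : 1 ≤ ρ)
    (hρr : ρ ^ 3 = (r : ℝ) ^ 2) (ha : 0 < a) (ht : |t| ≤ n / 2) :
    eigenvalue n r t ^ 2 / (a + ρ * (1 - eigenvalue n r t)) ≤
      (1 / a + 81 / 8) / (1 + (t * (ρ ^ 2 / n)) ^ 2) := by
  have hn' : (0 : ℝ) < n := by positivity
  set u := t * r / n with hu
  set v := eigenvalue n r t with hv
  have hv1 : v ≤ 1 := eigenvalue_le_one n r t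
  have hx : (t * (ρ ^ 2 / n)) ^ 2 = ρ * u ^ 2 := by
    rw [hu, div_pow, mul_pow t (r : ℝ), ← hρr]; field_simp
  rw [hx]
  set y := ρ * u ^ 2 with hy
  have hy0 : 0 ≤ y := by positivity
  have hden : 0 < a + ρ * (1 - v) := by nlinarith
  rw [div_le_div_iff₀ hden (by positivity)]
  -- low frequencies: the gap is quadratic; high frequencies: the eigenvalue is at most `1 / (2 |u|)`
  rcases le_total |u| 1 with h | h
  · have h1 := sq_le_one_sub_eigenvalue hn hr h
    have h2 : a + 8 / 81 * y ≤ a + ρ * (1 - v) := by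
      rw [hy]; nlinarith
    have h3 : v ^ 2 * (1 + y) ≤ 1 + y :=
      mul_le_of_le_one_left (by positivity) (eigenvalue_sq_le_one n r t)
    have h4 : (1 / a + 81 / 8) * (a + 8 / 81 * y) =
        1 + y + (81 / 8 * a + 8 / 81 * y / a) := by field_simp; ring
    have h5 : 0 ≤ 81 / 8 * a + 8 / 81 * y / a := by positivity
    have h6 : (1 / a + 81 / 8) * (a + 8 / 81 * y) ≤ (1 / a + 81 / 8) * (a + ρ * (1 - v)) :=
      mul_le_mul_of_nonneg_left h2 (by positivity)
    linarith
  · have h1 := abs_eigenvalue_mul_le hn (by omega : r ≠ 0) ht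
    rw [← hu, ← hv] at h1
    have hu2 : 1 ≤ u ^ 2 := by rw [← sq_abs]; nlinarith
    have h2 : v ^ 2 * (4 * u ^ 2) ≤ 1 := by
      have h3 : (|v| * (2 * |u|)) ^ 2 ≤ 1 := pow_le_one₀ (by positivity) h1
      have h4 : (|v| * (2 * |u|)) ^ 2 = v ^ 2 * (4 * u ^ 2) := by
        rw [mul_pow, mul_pow, sq_abs, sq_abs]; ring
      linarith
    have hv2 : v ≤ 1 / 2 := by
      have := le_abs_self v
      nlinarith [abs_nonneg v]
    have h5 : v ^ 2 * (1 + y) ≤ ρ / 2 := by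
      have h6 : 1 + y ≤ 2 * (ρ * u ^ 2) := by rw [hy]; nlinarith
      calc v ^ 2 * (1 + y) ≤ v ^ 2 * (2 * (ρ * u ^ 2)) :=
            mul_le_mul_of_nonneg_left h6 (sq_nonneg _)
        _ = ρ / 2 * (v ^ 2 * (4 * u ^ 2)) := by ring
        _ ≤ ρ / 2 * 1 := mul_le_mul_of_nonneg_left h2 (by positivity)
        _ = ρ / 2 := mul_one _
    have h7 : ρ / 2 ≤ a + ρ * (1 - v) := by nlinarith
    have h8 : a + ρ * (1 - v) ≤ (1 / a + 81 / 8) * (a + ρ * (1 - v)) := by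
      have : 0 < 1 / a := by positivity
      nlinarith
    linarith

end RiemannSum
end SpinChain

/-! ### Asymptotics of the saddle point -/

namespace SpinChain

section Asymptotics

variable {ι : Type*} {l : Filter ι} {N R : ι → ℕ} {ρ : ι → ℝ}

/-- At frequencies `t` with `t ρ² / N → τ`, where `ρ = R ^ (2 / 3)`, the spectral gap is asymptotic
to `(2π² / 3) τ² / ρ`. -/
theorem tendsto_mul_one_sub_eigenvalue (hN : ∀ i, N i ≠ 0) (hR : ∀ᶠ i in l, R i ≠ 0)
    (hρR : ∀ i, ρ i ^ 3 = (R i : ℝ) ^ 2) (hρ : Tendsto ρ l atTop)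
    {t : ι → ℝ} {τ : ℝ} (ht : Tendsto (fun i => t i * (ρ i ^ 2 / N i)) l (𝓝 τ)) :
    Tendsto (fun i => ρ i * (1 - eigenvalue (N i) (R i) (t i))) l
      (𝓝 (2 * Real.pi ^ 2 / 3 * τ ^ 2)) := by
  have hρinv : Tendsto (fun i => (ρ i)⁻¹) l (𝓝 0) := tendsto_inv_atTop_zero.comp hρ
  have hRat : Tendsto (fun i => ((R i : ℝ))⁻¹) l (𝓝 0) := by
    have h1 : Tendsto (fun i => ((R i : ℝ)) ^ 2) l atTop := by
      simp_rw [← hρR]; exact (tendsto_pow_atTop three_ne_zero).comp hρ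
    have h2 : Tendsto (fun i => √((R i : ℝ) ^ 2)) l atTop := Real.tendsto_sqrt_atTop.comp h1
    simp_rw [Real.sqrt_sq (Nat.cast_nonneg _)] at h2
    exact tendsto_inv_atTop_zero.comp h2
  set x : ι → ℝ := fun i => t i * (ρ i ^ 2 / N i) with hx
  have hpos : ∀ᶠ i in l, 0 < ρ i := hρ.eventually_gt_atTop 0
  have hq : ∀ᶠ i in l, (2 * Real.pi * t i / N i * R i) ^ 2 =
      4 * Real.pi ^ 2 * x i ^ 2 * (ρ i)⁻¹ := by
    filter_upwards [hpos] with i hi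
    have hNi : (N i : ℝ) ≠ 0 := by exact_mod_cast hN i
    rw [mul_pow _ (R i : ℝ), ← hρR, hx]
    field_simp
    ring
  have hsq0 : Tendsto (fun i => 4 * Real.pi ^ 2 * x i ^ 2 * (ρ i)⁻¹) l (𝓝 0) := by
    have := ((ht.pow 2).const_mul (4 * Real.pi ^ 2)).mul hρinv
    simpa using this
  have hsmall : ∀ᶠ i in l, |2 * Real.pi * t i / N i| * R i ≤ 1 := by
    filter_upwards [hq, hsq0.eventually_le_const one_pos] with i h1 h2
    rw [← h1] at h2
    have := (sq_le_one_iff_abs_le_one _).1 h2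
    rwa [abs_mul, Nat.abs_cast] at this
  have herr : Tendsto (fun i => ρ i * (4 * Real.pi ^ 2 * x i ^ 2 * (ρ i)⁻¹) ^ 2) l (𝓝 0) := by
    have h1 := (((ht.pow 2).const_mul (4 * Real.pi ^ 2)).pow 2).mul hρinv
    rw [mul_zero] at h1
    refine h1.congr' ?_
    filter_upwards [hpos] with i hi
    rw [mul_pow _ (ρ i)⁻¹]
    field_simp
  have hmain : Tendsto (fun i => 4 * Real.pi ^ 2 * x i ^ 2 *
      ((1 + ((R i : ℝ))⁻¹) * (2 + ((R i : ℝ))⁻¹) / 12)) l (𝓝 (2 * Real.pi ^ 2 / 3 * τ ^ 2)) := by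
    have := ((ht.pow 2).const_mul (4 * Real.pi ^ 2)).mul
      (((hRat.const_add 1).mul (hRat.const_add 2)).div_const 12)
    convert this using 2
    ring
  have hdiff : Tendsto (fun i => ρ i * (1 - eigenvalue (N i) (R i) (t i)) -
      4 * Real.pi ^ 2 * x i ^ 2 * ((1 + ((R i : ℝ))⁻¹) * (2 + ((R i : ℝ))⁻¹) / 12)) l (𝓝 0) := by
    refine squeeze_zero_norm' ?_ herr
    filter_upwards [hpos, hq, hsmall, hR] with i h1 h2 h3 hRi0
    have hRi : (R i : ℝ) ≠ 0 := by exact_mod_cast hRi0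
    have h4 := abs_one_sub_eigenvalue_sub_le hRi0 h3
    have h5 : 4 * Real.pi ^ 2 * x i ^ 2 * ((1 + ((R i : ℝ))⁻¹) * (2 + ((R i : ℝ))⁻¹) / 12) =
        ρ i * ((2 * Real.pi * t i / N i) ^ 2 * ((R i + 1) * (2 * R i + 1) / 12)) := by
      have h6 : 4 * Real.pi ^ 2 * x i ^ 2 = ρ i * (2 * Real.pi * t i / N i * R i) ^ 2 := by
        rw [h2]; field_simp
      rw [h6]; field_simp
    rw [h5, ← mul_sub, Real.norm_eq_abs, abs_mul, abs_of_pos h1, ← h2]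
    refine mul_le_mul_of_nonneg_left (h4.trans_eq ?_) h1.le
    ring
  simpa using hdiff.add hmain

variable [l.IsCountablyGenerated]

/-- The second order part of the resolvent trace is a Riemann sum of mesh `ρ² / N`. -/
theorem tendsto_sum_eigenvalue_sq_div (hN : ∀ i, N i ≠ 0) (hR : ∀ᶠ i in l, 2 ≤ R i)
    (hρR : ∀ i, ρ i ^ 3 = (R i : ℝ) ^ 2) (hρ : Tendsto ρ l atTop)
    (hmesh : Tendsto (fun i => ρ i ^ 2 / N i) l (𝓝 0)) {a : ℝ} (ha : 0 < a) :
    Tendsto (fun i => ρ i ^ 2 / N i * ∑ k : Fin (N i), eigenvalue (N i) (R i) k ^ 2 /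
      (a + ρ i * (1 - eigenvalue (N i) (R i) k))) l
      (𝓝 (Real.pi / √(a * (2 * Real.pi ^ 2 / 3)))) := by
  set h : ι → ℝ := fun i => ρ i ^ 2 / N i with hh
  set F : ι → ℝ → ℝ := fun i t => eigenvalue (N i) (R i) t ^ 2 /
      (a + ρ i * (1 - eigenvalue (N i) (R i) t)) with hF
  set S : ι → Finset ℤ := fun i => Finset.Ico (-((N i / 2 : ℕ) : ℤ)) (N i - (N i / 2 : ℕ)) with hS
  set φ : ι → ℝ → ℝ := fun i τ => if ⌊τ / h i⌋ ∈ S i then F i ⌊τ / h i⌋ else 0 with hφ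
  have hc : (0 : ℝ) < 2 * Real.pi ^ 2 / 3 := by positivity
  have hN0 : ∀ i, (0 : ℝ) < N i := fun i => by have := hN i; positivity
  have hpos : ∀ᶠ i in l, 1 ≤ ρ i := hρ.eventually_ge_atTop 1
  have hhpos : ∀ᶠ i in l, 0 < h i := by
    filter_upwards [hpos] with i hi
    have := hN0 i
    positivity
  have hint : ∀ᶠ i in l, h i * ∑ k : Fin (N i), F i k = ∫ τ, φ i τ := by
    filter_upwards [hhpos] with i hi
    rw [integral_floor_step hi (S i) fun k => F i k, sum_fin_eq_sum_Ico (m := N i / 2) _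
      (Nat.div_le_self _ _)]
    intro t
    simp only [hF, eigenvalue_add_period (hN i)]
  rw [← integral_inv_add_mul_sq ha hc]
  refine Tendsto.congr' (EventuallyEq.symm hint) ?_
  have hSbound : ∀ i, ∀ k ∈ S i, |(k : ℝ)| ≤ (N i : ℝ) / 2 := fun i k hk => by
    rw [hS, Finset.mem_Ico] at hk
    rw [abs_le]
    have h1 : -(N i : ℤ) ≤ 2 * k := by omega
    have h2 : 2 * k ≤ (N i : ℤ) := by omega
    have h1' : -(N i : ℝ) ≤ 2 * k := by exact_mod_cast h1
    have h2' : 2 * (k : ℝ) ≤ N i := by exact_mod_cast h2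
    constructor <;> linarith
  have hfloor : ∀ i, 0 < h i → ∀ τ : ℝ, |⌊τ / h i⌋ * h i - τ| ≤ h i := fun i hi τ => by
    have h1 := Int.floor_le (τ / h i)
    have h2 := (Int.lt_floor_add_one (τ / h i)).le
    rw [le_div_iff₀ hi] at h1
    rw [div_le_iff₀ hi] at h2
    rw [abs_le]
    constructor <;> linarith
  refine tendsto_integral_filter_of_dominated_convergence
    (fun τ => 3 * (1 / a + 81 / 8) * (1 + τ ^ 2)⁻¹) ?_ ?_ (integrable_inv_one_add_sq.const_mul _) ?_
  · refine Eventually.of_forall fun i => Measurable.aestronglyMeasurable ?_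
    have hm : Measurable fun τ : ℝ => ⌊τ / h i⌋ := Int.measurable_floor.comp (by fun_prop)
    exact (measurable_from_top (f := fun k : ℤ => if k ∈ S i then F i k else 0)).comp hm
  · filter_upwards [hpos, hhpos, hmesh.eventually_le_const one_pos, hR] with i h1 h2 h3 hRi
    refine Eventually.of_forall fun τ => ?_
    simp only [hφ]
    split_ifs with hk
    · have hb := summand_le (hN i) hRi h1 (hρR i) ha (hSbound i _ hk)
      have h0 : 0 ≤ F i ⌊τ / h i⌋ := by
        have := eigenvalue_le_one (N i) (R i) ⌊τ / h i⌋
        exact div_nonneg (sq_nonneg _) (by nlinarith)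
      rw [Real.norm_of_nonneg h0]
      refine hb.trans ?_
      have hf := hfloor i h2 τ
      change (1 / a + 81 / 8) / (1 + (⌊τ / h i⌋ * h i) ^ 2) ≤ _
      set y := ⌊τ / h i⌋ * h i
      have h4 : |y - τ| ≤ 1 := hf.trans h3
      have h5 : 1 + τ ^ 2 ≤ 3 * (1 + y ^ 2) := by
        have h6 : (y - τ) ^ 2 ≤ 1 := by rw [← sq_abs]; exact pow_le_one₀ (abs_nonneg _) h4
        nlinarith [sq_nonneg (y - (τ - y))]
      rw [← div_eq_mul_inv, div_le_div_iff₀ (by positivity) (by positivity)]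
      have : 0 < 1 / a + 81 / 8 := by positivity
      nlinarith
    · rw [norm_zero]; positivity
  · refine Eventually.of_forall fun τ => ?_
    have hkh : Tendsto (fun i => (⌊τ / h i⌋ : ℝ) * (ρ i ^ 2 / N i)) l (𝓝 τ) := by
      rw [tendsto_iff_norm_sub_tendsto_zero]
      refine squeeze_zero' (Eventually.of_forall fun _ => norm_nonneg _) ?_ hmesh
      filter_upwards [hhpos] with i hi using hfloor i hi τ
    have hgap := tendsto_mul_one_sub_eigenvalue hN (hR.mono fun i hi => by omega) hρR hρ hkh
    have heig : Tendsto (fun i => eigenvalue (N i) (R i) ⌊τ / h i⌋) l (𝓝 1) := by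
      have h1 := (hgap.mul (tendsto_inv_atTop_zero.comp hρ)).const_sub 1
      rw [mul_zero, sub_zero] at h1
      refine h1.congr' ?_
      filter_upwards [hpos] with i hi
      have : ρ i ≠ 0 := by positivity
      simp only [Function.comp]
      field_simp
      ring
    have hlim : Tendsto (fun i => F i ⌊τ / h i⌋) l (𝓝 (1 / (a + 2 * Real.pi ^ 2 / 3 * τ ^ 2))) := by
      have := (heig.pow 2).div (hgap.const_add a) (by positivity)
      rwa [one_pow] at this
    refine hlim.congr' ?_
    have hin : ∀ᶠ i in l, |τ| + 2 ≤ ρ i ^ 2 / 2 := by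
      have : Tendsto (fun i => ρ i ^ 2 / 2) l atTop :=
        ((tendsto_pow_atTop two_ne_zero).comp hρ).atTop_div_const two_pos
      exact this.eventually_ge_atTop _
    filter_upwards [hhpos, hin, hmesh.eventually_le_const one_pos] with i h1 h2 h3
    have hmem : ⌊τ / h i⌋ ∈ S i := by
      have hf := hfloor i h1 τ
      set k := ⌊τ / h i⌋
      have hNh : (N i : ℝ) * h i = ρ i ^ 2 := by
        have := (hN0 i).ne'
        simp only [hh]; field_simp
      have h5 : |(k : ℝ)| * h i ≤ |τ| + 1 := by
        rw [show |(k : ℝ)| * h i = |(k : ℝ) * h i| by rw [abs_mul, abs_of_pos h1]]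
        have h6 := abs_sub_abs_le_abs_sub ((k : ℝ) * h i) τ
        have h7 : h i ≤ 1 := h3
        linarith
      have h8 : (|(k : ℝ)| + 1) * h i ≤ N i / 2 * h i := by
        have h7 : h i ≤ 1 := h3
        linarith
      have h9 : |(k : ℝ)| + 1 ≤ N i / 2 := le_of_mul_le_mul_right h8 h1
      have h10 : 2 * (|k| + 1) ≤ (N i : ℤ) := by
        have : 2 * (|(k : ℝ)| + 1) ≤ N i := by linarith
        exact_mod_cast this
      rw [hS, Finset.mem_Ico]
      have h11 := le_abs_self k
      have h12 := neg_abs_le k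
      omega
    simp only [hφ, if_pos hmem]

/-- The position of the saddle point: `ε ρ → (3 / 2) ^ (1 / 3)`. -/
theorem tendsto_saddle (hN : ∀ i, N i ≠ 0) (hR : ∀ᶠ i in l, 2 ≤ R i) (hRN : ∀ᶠ i in l, R i < N i)
    (hρR : ∀ i, ρ i ^ 3 = (R i : ℝ) ^ 2) (hρ : Tendsto ρ l atTop)
    (hmesh : Tendsto (fun i => ρ i ^ 2 / N i) l (𝓝 0)) {ε : ι → ℝ} (hε : ∀ᶠ i in l, 0 < ε i)
    (h : ∀ᶠ i in l, resolventTrace (N i) (R i) (ε i) = N i) :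
    Tendsto (fun i => ε i * ρ i) l (𝓝 ((3 / 2) ^ (1 / 3 : ℝ))) := by
  have hpos : ∀ᶠ i in l, 0 < ρ i := hρ.eventually_gt_atTop 0
  have hD : ∀ a : ℝ, 0 < a → Tendsto
      (fun i => ρ i / N i * (resolventTrace (N i) (R i) (a / ρ i) - N i)) l
      (𝓝 (Real.pi / √(a * (2 * Real.pi ^ 2 / 3)) - a)) := fun a ha => by
    have h1 : Tendsto (fun i => 1 + a / ρ i) l (𝓝 1) := by
      simpa using (hρ.const_div_atTop a).const_add 1
    have h2 := tendsto_sum_eigenvalue_sq_div hN hR hρR hρ hmesh ha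
    have h3 : Tendsto (fun i => 1 / (1 + a / ρ i) ^ 2 * (ρ i ^ 2 / N i *
        ∑ k : Fin (N i), eigenvalue (N i) (R i) k ^ 2 /
          (a + ρ i * (1 - eigenvalue (N i) (R i) k))) - a / (1 + a / ρ i)) l
        (𝓝 (1 / 1 ^ 2 * (Real.pi / √(a * (2 * Real.pi ^ 2 / 3))) - a / 1)) :=
      ((tendsto_const_nhds.div (h1.pow 2) (by norm_num)).mul h2).sub
        (tendsto_const_nhds.div h1 one_ne_zero)
    simp only [one_pow, div_one, one_mul] at h3
    refine h3.congr' ?_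
    filter_upwards [hpos, hRN] with i hi hRNi
    have : NeZero (N i) := ⟨hN i⟩
    have hNi : (0 : ℝ) < N i := by exact_mod_cast NeZero.pos (N i)
    have haρ : 0 < a / ρ i := by positivity
    rw [resolventTrace_eq hRNi haρ]
    have h4 : ∀ k : Fin (N i), eigenvalue (N i) (R i) k ^ 2 /
        (1 + a / ρ i - eigenvalue (N i) (R i) k) = ρ i * (eigenvalue (N i) (R i) k ^ 2 /
          (a + ρ i * (1 - eigenvalue (N i) (R i) k))) := fun k => by
      have h5 : a + ρ i * (1 - eigenvalue (N i) (R i) k) =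
          ρ i * (1 + a / ρ i - eigenvalue (N i) (R i) k) := by field_simp; ring
      rw [h5]
      have := (resolvent_denom_pos (n := N i) (r := R i) haρ k).ne'
      field_simp
    rw [Finset.sum_congr rfl fun k _ => h4 k, ← Finset.mul_sum]
    have h6 : (1 : ℝ) + a / ρ i ≠ 0 := by positivity
    generalize ∑ k : Fin (N i), eigenvalue (N i) (R i) k ^ 2 /
      (a + ρ i * (1 - eigenvalue (N i) (R i) k)) = Q
    have h7 : (N i : ℝ) / (1 + a / ρ i) - N i = - (N i * a / ρ i / (1 + a / ρ i)) := by
      field_simp; ring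
    rw [show (N i : ℝ) / (1 + a / ρ i) + 1 / (1 + a / ρ i) ^ 2 * (ρ i * Q) - N i =
      1 / (1 + a / ρ i) ^ 2 * (ρ i * Q) + ((N i : ℝ) / (1 + a / ρ i) - N i) by ring, h7]
    generalize 1 + a / ρ i = s at h6 ⊢
    field_simp
    ring
  have hval : ∀ a : ℝ, 0 < a → (Real.pi / √(a * (2 * Real.pi ^ 2 / 3))) ^ 2 = 3 / 2 / a :=
    fun a ha => by
      rw [div_pow, Real.sq_sqrt (by positivity)]
      have := Real.pi_pos.ne'
      field_simp
  set A : ℝ := (3 / 2) ^ (1 / 3 : ℝ) with hA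
  have hA0 : 0 < A := by positivity
  have hA3 : A ^ 3 = 3 / 2 := by
    rw [hA, ← Real.rpow_natCast, ← Real.rpow_mul (by norm_num)]
    norm_num
  rw [tendsto_order]
  constructor
  · intro a haA
    rcases le_or_gt a 0 with ha | ha
    · filter_upwards [hpos, hε] with i hi hεi
      exact ha.trans_lt (mul_pos hεi hi)
    have hlim : 0 < Real.pi / √(a * (2 * Real.pi ^ 2 / 3)) - a := by
      rw [sub_pos]
      refine lt_of_pow_lt_pow_left₀ 2 (by positivity) ?_
      rw [hval a ha, lt_div_iff₀ ha, ← hA3]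
      calc a ^ 2 * a = a ^ 3 := by ring
        _ < A ^ 3 := pow_lt_pow_left₀ haA ha.le three_ne_zero
    filter_upwards [hpos, (hD a ha).eventually_const_lt hlim, hε, h] with i h1 h2 hεi hi
    have hNi : (0 : ℝ) < N i := by have := hN i; positivity
    have h3 : (N i : ℝ) < resolventTrace (N i) (R i) (a / ρ i) :=
      sub_pos.1 ((mul_pos_iff_of_pos_left (by positivity)).1 h2)
    rw [← hi] at h3
    have h4 : a / ρ i < ε i := by
      by_contra hcon
      exact absurd h3 (not_lt.2 (resolventTrace_antitone hεi (not_lt.1 hcon)))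
    rwa [div_lt_iff₀ h1] at h4
  · intro a haA
    have ha : 0 < a := hA0.trans haA
    have hlim : Real.pi / √(a * (2 * Real.pi ^ 2 / 3)) - a < 0 := by
      rw [sub_neg]
      refine lt_of_pow_lt_pow_left₀ 2 ha.le ?_
      rw [hval a ha, div_lt_iff₀ ha, ← hA3]
      calc A ^ 3 < a ^ 3 := pow_lt_pow_left₀ haA hA0.le three_ne_zero
        _ = a ^ 2 * a := by ring
    filter_upwards [hpos, (hD a ha).eventually_lt_const hlim, hε, h] with i h1 h2 hεi hi
    have hNi : (0 : ℝ) < N i := by have := hN i; positivity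
    have h3 : resolventTrace (N i) (R i) (a / ρ i) < N i := by
      by_contra hcon
      exact absurd h2 (not_lt.2 (mul_nonneg (by positivity) (sub_nonneg.2 (not_lt.1 hcon))))
    rw [← hi] at h3
    have h4 : ε i < a / ρ i := by
      by_contra hcon
      exact absurd h3 (not_lt.2 (resolventTrace_antitone (by positivity) (not_lt.1 hcon)))
    rwa [lt_div_iff₀ h1] at h4

end Asymptotics
end SpinChain

/-! ### Concentration of the squared norms and comparison of the tilts -/

namespace SpinChain

section Moments

variable {n : ℕ}

theorem memLp_sq_gaussianReal : MemLp (fun x : ℝ => x ^ 2) 2 (gaussianReal 0 1) := by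
  have h : MemLp (id : ℝ → ℝ) 4 (gaussianReal 0 1) := memLp_id_gaussianReal' 4 (by simp)
  have h2 := h.norm_rpow_div (2 : ℝ≥0∞)
  have e : (4 : ℝ≥0∞) / 2 = 2 := by
    rw [show (4 : ℝ≥0∞) = 2 * 2 by norm_num, mul_div_assoc, ENNReal.div_self (by simp) (by simp),
      mul_one]
  rw [e] at h2
  refine h2.congr_norm (by fun_prop) (Eventually.of_forall fun x => ?_)
  simp

theorem integral_sq_gaussianReal : ∫ x : ℝ, x ^ 2 ∂gaussianReal 0 1 = 1 := by
  have h := variance_id_gaussianReal (μ := 0) (v := 1)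
  rw [variance_of_integral_eq_zero (by fun_prop) (by simp)] at h
  simpa using h

/-- The variance of the square of a standard normal variable. Its exact value, `2`, plays no
role. -/
noncomputable def varSq : ℝ := Var[fun x : ℝ => x ^ 2; gaussianReal 0 1]

theorem varSq_nonneg : 0 ≤ varSq := variance_nonneg _ _

/-- Chebyshev's inequality for a weighted sum of squares of independent standard normal variables. -/
theorem measure_sum_mul_sq_sub_ge (a : Fin n → ℝ) {c : ℝ} (hc : 0 < c) :
    (gaussianSpins n).real {g | c ≤ |∑ k, a k * g k ^ 2 - ∑ k, a k|} ≤
      varSq * (∑ k, a k ^ 2) / c ^ 2 := by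
  have hm : ∀ k, MemLp (fun x : ℝ => a k * x ^ 2) 2 (gaussianReal 0 1) := fun k =>
    memLp_sq_gaussianReal.const_mul _
  have hmk : ∀ k, MemLp (fun g : Fin n → ℝ => a k * g k ^ 2) 2 (gaussianSpins n) := fun k =>
    (hm k).comp_measurePreserving (measurePreserving_eval (fun _ : Fin n => gaussianReal 0 1) k)
  have hS : MemLp (∑ k, fun g : Fin n → ℝ => a k * g k ^ 2) 2 (gaussianSpins n) :=
    memLp_finsetSum' _ fun k _ => hmk k
  have hvar : Var[∑ k, fun g : Fin n → ℝ => a k * g k ^ 2; gaussianSpins n] =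
      varSq * ∑ k, a k ^ 2 := by
    unfold gaussianSpins
    rw [variance_sum_pi (X := fun k (x : ℝ) => a k * x ^ 2) hm, Finset.mul_sum]
    refine Finset.sum_congr rfl fun k _ => ?_
    rw [variance_const_mul, varSq, mul_comm]
  have hmean : (gaussianSpins n)[∑ k, fun g : Fin n → ℝ => a k * g k ^ 2] = ∑ k, a k := by
    simp only [Finset.sum_apply]
    rw [integral_finsetSum _ fun k _ => (hmk k).integrable (by norm_num)]
    refine Finset.sum_congr rfl fun k _ => ?_
    rw [integral_const_mul]
    have := integral_comp_eval (μ := fun _ : Fin n => gaussianReal 0 1) (i := k)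
      (f := fun x : ℝ => x ^ 2) (by fun_prop)
    unfold gaussianSpins
    rw [this, integral_sq_gaussianReal, mul_one]
  have h := meas_ge_le_variance_div_sq hS hc
  rw [hvar, hmean] at h
  simp only [Finset.sum_apply] at h
  exact ENNReal.toReal_le_of_le_ofReal
    (div_nonneg (mul_nonneg varSq_nonneg (Finset.sum_nonneg fun _ _ => sq_nonneg _))
      (sq_nonneg _)) h

/-- The event that both squared norms deviate from `n` by at most `M √n` and that the coordinate of
frequency `0` is at most `√M` in absolute value. -/
def typicalSet [NeZero n] (b : Fin n → ℝ) (M : ℝ) : Set (Fin n → ℝ) :=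
  {g | |normSq g - n| ≤ M * √(n : ℝ) ∧ |scaledNormSq b g - n| ≤ M * √(n : ℝ) ∧ g 0 ^ 2 ≤ M}

variable [NeZero n]

theorem measurableSet_typicalSet (b : Fin n → ℝ) (M : ℝ) : MeasurableSet (typicalSet b M) := by
  have h1 : Measurable fun g : Fin n → ℝ => |normSq g - n| := by fun_prop
  have h2 : Measurable fun g : Fin n → ℝ => |scaledNormSq b g - n| := by fun_prop
  have h3 : Measurable fun g : Fin n → ℝ => g 0 ^ 2 := by fun_prop
  exact (measurableSet_le h1 measurable_const).inter
    ((measurableSet_le h2 measurable_const).inter (measurableSet_le h3 measurable_const))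

theorem measure_compl_typicalSet_le {b : Fin n → ℝ} (h1 : ∑ k, 1 / b k = n)
    (h2 : ∑ k, (1 / b k) ^ 2 ≤ 4 * (n : ℝ)) {M : ℝ} (hM : 1 ≤ M) :
    (gaussianSpins n).real (typicalSet b M)ᶜ ≤ (5 * varSq + 1) / M := by
  have hn : (0 : ℝ) < n := by exact_mod_cast NeZero.pos n
  have hv := varSq_nonneg
  have hc : 0 < M * √(n : ℝ) := by positivity
  have hc2 : (M * √(n : ℝ)) ^ 2 = M ^ 2 * n := by rw [mul_pow, Real.sq_sqrt hn.le]
  have hA := measure_sum_mul_sq_sub_ge (fun _ : Fin n => (1 : ℝ)) hc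
  have hB := measure_sum_mul_sq_sub_ge (fun k => 1 / b k) hc
  rw [hc2] at hA hB
  have hA' : varSq * (∑ k : Fin n, (1 : ℝ) ^ 2) / (M ^ 2 * n) ≤ varSq / M := by
    simp only [one_pow, Finset.sum_const, Finset.card_univ, Fintype.card_fin, nsmul_eq_mul, mul_one]
    rw [mul_div_mul_right _ _ hn.ne']
    exact div_le_div_of_nonneg_left hv (by positivity) (by nlinarith)
  have hB' : varSq * (∑ k : Fin n, (1 / b k) ^ 2) / (M ^ 2 * n) ≤ 4 * varSq / M := by
    calc _ ≤ varSq * (4 * n) / (M ^ 2 * n) := by gcongr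
      _ = 4 * varSq / M ^ 2 := by field_simp
      _ ≤ _ := div_le_div_of_nonneg_left (by positivity) (by positivity) (by nlinarith)
  have hev : MeasurePreserving (Function.eval (0 : Fin n)) (gaussianSpins n) (gaussianReal 0 1) :=
    measurePreserving_eval (fun _ : Fin n => gaussianReal 0 1) 0
  have hC : (gaussianSpins n).real {g | M ≤ g 0 ^ 2} ≤ 1 / M := by
    have hint : Integrable (fun g : Fin n → ℝ => g 0 ^ 2) (gaussianSpins n) :=
      (memLp_sq_gaussianReal.comp_measurePreserving hev).integrable (by norm_num)
    have h := mul_meas_ge_le_integral_of_nonneg (Eventually.of_forall fun g : Fin n → ℝ => sq_nonneg (g 0))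
      hint M
    have hone : ∫ g, g 0 ^ 2 ∂gaussianSpins n = 1 := by
      have := integral_comp_eval (μ := fun _ : Fin n => gaussianReal 0 1) (i := 0)
        (f := fun x : ℝ => x ^ 2) (by fun_prop)
      unfold gaussianSpins
      rw [this, integral_sq_gaussianReal]
    rw [hone] at h
    rw [le_div_iff₀ (by positivity), mul_comm]
    exact h
  have hsub : (typicalSet b M)ᶜ ⊆
      {g | M * √(n : ℝ) ≤ |∑ k : Fin n, 1 * g k ^ 2 - ∑ k : Fin n, (1 : ℝ)|} ∪
      ({g | M * √(n : ℝ) ≤ |∑ k, 1 / b k * g k ^ 2 - ∑ k, 1 / b k|} ∪ {g | M ≤ g 0 ^ 2}) := by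
    intro g hg
    by_contra hcon
    simp only [Set.mem_union, Set.mem_ofPred_eq, not_or, not_le] at hcon
    obtain ⟨hc1, hc2, hc3⟩ := hcon
    refine hg ⟨?_, ?_, hc3.le⟩
    · simpa [normSq] using hc1.le
    · rw [h1] at hc2
      have e : scaledNormSq b g = ∑ k, 1 / b k * g k ^ 2 :=
        Finset.sum_congr rfl fun k _ => by ring
      rw [e]
      exact hc2.le
  have hu := (measureReal_mono (μ := gaussianSpins n) hsub).trans
    ((measureReal_union_le _ _).trans (add_le_add_right (measureReal_union_le _ _) _))
  have e : (5 * varSq + 1) / M = varSq / M + (4 * varSq / M + 1 / M) := by ring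
  rw [e]
  linarith

end Moments

section Comparison

variable {n : ℕ} [NeZero n] {b : Fin n → ℝ} {M : ℝ} {g : Fin n → ℝ}

theorem normSq_update_zero (g : Fin n → ℝ) :
    normSq (Function.update g 0 0) = normSq g - g 0 ^ 2 := by
  unfold normSq
  rw [← Finset.add_sum_erase _ _ (Finset.mem_univ 0),
    ← Finset.add_sum_erase (f := fun k => g k ^ 2) _ (Finset.mem_univ 0)]
  simp only [Function.update_self]
  rw [Finset.sum_congr rfl fun k hk => by rw [Function.update_of_ne (Finset.ne_of_mem_erase hk)]]
  ring

theorem scaledNormSq_update_zero (b g : Fin n → ℝ) :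
    scaledNormSq b (Function.update g 0 0) = scaledNormSq b g - g 0 ^ 2 / b 0 := by
  unfold scaledNormSq
  rw [← Finset.add_sum_erase _ _ (Finset.mem_univ 0),
    ← Finset.add_sum_erase (f := fun k => g k ^ 2 / b k) _ (Finset.mem_univ 0)]
  simp only [Function.update_self]
  rw [Finset.sum_congr rfl fun k hk => by rw [Function.update_of_ne (Finset.ne_of_mem_erase hk)]]
  ring

/-- A Lipschitz estimate for `ψ(p) = 1 - p + log p`, whose derivative vanishes at `1`. -/
theorem log_sub_self_sub_le {p q : ℝ} (hp : 0 < p) (hq : 0 < q) :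
    (1 - p + Real.log p) - (1 - q + Real.log q) ≤ |p - q| * (|1 - q| / q) := by
  have h := Real.log_le_sub_one_of_pos (div_pos hp hq)
  rw [Real.log_div hp.ne' hq.ne'] at h
  calc (1 - p + Real.log p) - (1 - q + Real.log q) ≤ (p - q) * ((1 - q) / q) := by
        have : p / q - 1 = (p - q) / q := by field_simp
        have h2 : (p - q) * ((1 - q) / q) = (p - q) / q - (p - q) := by field_simp
        linarith
    _ ≤ |(p - q) * ((1 - q) / q)| := le_abs_self _
    _ = _ := by rw [abs_mul, abs_div, abs_of_pos hq]

theorem abs_exp_sub_exp_le {x y : ℝ} (hx : x ≤ 0) (hy : y ≤ 0) :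
    |Real.exp x - Real.exp y| ≤ |x - y| := by
  wlog h : y ≤ x generalizing x y
  · rw [abs_sub_comm, abs_sub_comm x]
    exact this hy hx (le_of_not_ge h)
  rw [abs_of_nonneg (sub_nonneg.2 (Real.exp_le_exp.2 h)), abs_of_nonneg (sub_nonneg.2 h)]
  have h1 := Real.add_one_le_exp (y - x)
  have h2 : Real.exp y = Real.exp x * Real.exp (y - x) := by rw [← Real.exp_add]; congr 1; ring
  have h3 := Real.exp_le_one_iff.2 hx
  have h4 := Real.exp_pos x
  rw [h2]
  nlinarith

theorem typicalSet_bounds (hM : 4 * M ≤ √(n : ℝ)) (hg : g ∈ typicalSet b M) :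
    3 / 4 * (n : ℝ) ≤ normSq g ∧ normSq g ≤ 5 / 4 * n ∧
      3 / 4 * (n : ℝ) ≤ scaledNormSq b g ∧ scaledNormSq b g ≤ 5 / 4 * n := by
  obtain ⟨h1, h2, -⟩ := hg
  have hn : (0 : ℝ) ≤ n := n.cast_nonneg
  have hs : M * √(n : ℝ) ≤ n / 4 := by
    have := mul_le_mul_of_nonneg_right hM (Real.sqrt_nonneg n)
    rw [Real.mul_self_sqrt hn] at this
    linarith
  rw [abs_le] at h1 h2
  refine ⟨?_, ?_, ?_, ?_⟩ <;> linarith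

theorem abs_normSq_div_sub_one_le {g' : Fin n → ℝ} (hM : 4 * M ≤ √(n : ℝ))
    (hg : g ∈ typicalSet b M) (hg' : g' ∈ typicalSet b M) :
    |normSq g' / scaledNormSq b g - 1| ≤ 8 / 3 * M / √(n : ℝ) := by
  have hn : (0 : ℝ) < n := by exact_mod_cast NeZero.pos n
  obtain ⟨-, -, hV, -⟩ := typicalSet_bounds hM hg
  have hV0 : 0 < scaledNormSq b g := by linarith
  have hsn := Real.mul_self_sqrt hn.le
  have hs0 : 0 < √(n : ℝ) := Real.sqrt_pos.2 hn
  rw [div_sub_one hV0.ne', abs_div, abs_of_pos hV0, div_le_div_iff₀ hV0 hs0]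
  have h1 : |normSq g' - scaledNormSq b g| ≤ 2 * (M * √(n : ℝ)) := by
    have := abs_sub_le (normSq g') (n : ℝ) (scaledNormSq b g)
    rw [abs_sub_comm (n : ℝ)] at this
    linarith [hg'.1, hg.2.1]
  have hM0 : 0 ≤ M := le_trans (sq_nonneg _) hg.2.2
  calc _ ≤ 2 * (M * √(n : ℝ)) * √(n : ℝ) := mul_le_mul_of_nonneg_right h1 hs0.le
    _ = 8 / 3 * M * (3 / 4 * n) := by rw [mul_assoc, mul_assoc, hsn]; ring
    _ ≤ _ := mul_le_mul_of_nonneg_left hV (by positivity)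

/-- The tilt is bounded below on typical configurations, since `ψ(p) ≥ -(p - 1)² / p`. -/
theorem exp_neg_le_tilt (hM : 4 * M ≤ √(n : ℝ)) (hg : g ∈ typicalSet b M) :
    Real.exp (-(6 * M ^ 2)) ≤ tilt b g := by
  have hn : (0 : ℝ) < n := by exact_mod_cast NeZero.pos n
  obtain ⟨hX, -, hV, hV'⟩ := typicalSet_bounds hM hg
  have hp1 := abs_normSq_div_sub_one_le hM hg hg
  have hM0 : 0 ≤ M := le_trans (sq_nonneg _) hg.2.2
  unfold tilt
  set p := normSq g / scaledNormSq b g with hp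
  have hp35 : 3 / 5 ≤ p := by
    rw [hp, le_div_iff₀ (by linarith)]; linarith
  have hp0 : 0 < p := by linarith
  rw [Real.exp_le_exp]
  have hlog := Real.one_sub_inv_le_log_of_pos hp0
  have h1 : -((p - 1) ^ 2 / p) ≤ 1 - p + Real.log p := by
    have : 1 - p + (1 - p⁻¹) = -((p - 1) ^ 2 / p) := by field_simp; ring
    linarith
  have h2 : (p - 1) ^ 2 ≤ 64 / 9 * M ^ 2 / n := by
    rw [← sq_abs]
    calc |p - 1| ^ 2 ≤ (8 / 3 * M / √(n : ℝ)) ^ 2 := pow_le_pow_left₀ (abs_nonneg _) hp1 2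
      _ = _ := by rw [div_pow, Real.sq_sqrt hn.le]; ring
  have h3 : (p - 1) ^ 2 / p ≤ 64 / 9 * M ^ 2 / n * (5 / 3) := by
    rw [div_le_iff₀ hp0]
    have : 0 ≤ 64 / 9 * M ^ 2 / n := by positivity
    nlinarith
  have h4 : (n : ℝ) / 2 * (64 / 9 * M ^ 2 / n * (5 / 3)) = 160 / 27 * M ^ 2 := by
    field_simp; ring
  have h5 : (n : ℝ) / 2 * (-(64 / 9 * M ^ 2 / n * (5 / 3))) ≤ n / 2 * (1 - p + Real.log p) :=
    mul_le_mul_of_nonneg_left (by linarith) (by positivity)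
  nlinarith [sq_nonneg M]

/-- On typical configurations the coordinate of frequency `0` hardly affects the tilt. The minimum
with `1` keeps the modified tilt bounded where the remaining coordinates all vanish. -/
theorem abs_tilt_sub_tilt_update_le (hb : ∀ k, 0 < b k) (hb0 : b 0 ≤ 1) (hM : 1 ≤ M)
    (hMb : M / (b 0 * √(n : ℝ)) ≤ 1 / 4) (hg : g ∈ typicalSet b M) :
    |tilt b g - min 1 (tilt b (Function.update g 0 0))| ≤ 25 * M ^ 2 / (b 0 * √(n : ℝ)) := by
  have hn : (0 : ℝ) < n := by exact_mod_cast NeZero.pos n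
  have hs0 : 0 < √(n : ℝ) := Real.sqrt_pos.2 hn
  have hsn := Real.mul_self_sqrt hn.le
  have hb00 := hb 0
  have hMb' : M / b 0 ≤ √(n : ℝ) / 4 := by
    rw [div_le_div_iff₀ (by positivity) (by norm_num)] at hMb
    rw [div_le_div_iff₀ hb00 (by norm_num)]
    linarith
  have hMle : M ≤ M / b 0 := by rw [le_div_iff₀ hb00]; nlinarith
  have hM4 : 4 * M ≤ √(n : ℝ) := by linarith
  obtain ⟨hX, hX', hV, hV'⟩ := typicalSet_bounds hM4 hg
  have hgM : g 0 ^ 2 ≤ M := hg.2.2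
  have hg0 : 0 ≤ g 0 ^ 2 := sq_nonneg _
  set y := g 0 ^ 2 / b 0 with hy
  have hyM : y ≤ M / b 0 := div_le_div_of_nonneg_right hgM hb00.le
  have hyg : g 0 ^ 2 ≤ y := by rw [hy, le_div_iff₀ hb00]; nlinarith
  have hs1 : 1 ≤ √(n : ℝ) := by linarith
  have hsle : √(n : ℝ) ≤ n := by nlinarith
  have hX'e := normSq_update_zero g
  have hV'e := scaledNormSq_update_zero b g
  rw [← hy] at hV'e
  have hp1 := abs_normSq_div_sub_one_le hM4 hg hg
  set X := normSq g
  set V := scaledNormSq b g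
  have hV0 : 0 < V := by linarith
  have hX0 : 0 < X := by linarith
  have hXl : (n : ℝ) / 2 ≤ X - g 0 ^ 2 := by linarith
  have hVl : (n : ℝ) / 2 ≤ V - y := by linarith
  have hV20 : 0 < V - y := by linarith
  have hX20 : 0 < X - g 0 ^ 2 := by linarith
  have hle : tilt b (Function.update g 0 0) ≤ 1 := tilt_le_one hb (by rw [hX'e]; exact hX20)
  rw [min_eq_right hle]
  have hpq : |X / V - (X - g 0 ^ 2) / (V - y)| ≤ 10 / 3 * (M / b 0) / n := by
    have e : X / V - (X - g 0 ^ 2) / (V - y) = (g 0 ^ 2 * V - X * y) / (V * (V - y)) := by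
      field_simp; ring
    have h1 : |g 0 ^ 2 * V - X * y| ≤ M / b 0 * (5 / 4 * n) := by
      have hMb0 : 0 ≤ M / b 0 := by positivity
      have h2 : g 0 ^ 2 * V ≤ M / b 0 * (5 / 4 * n) :=
        mul_le_mul (by linarith) hV' hV0.le hMb0
      have h3 : X * y ≤ M / b 0 * (5 / 4 * n) := by
        rw [mul_comm]
        exact mul_le_mul hyM hX' hX0.le hMb0
      have h4 : 0 ≤ g 0 ^ 2 * V := by positivity
      have h5 : 0 ≤ X * y := mul_nonneg hX0.le (by linarith)
      rw [abs_le]; constructor <;> linarith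
    rw [e, abs_div, abs_of_pos (mul_pos hV0 hV20), div_le_div_iff₀ (mul_pos hV0 hV20) hn]
    have h6 : 3 / 4 * n * ((n : ℝ) / 2) ≤ V * (V - y) :=
      mul_le_mul hV hVl (by positivity) hV0.le
    calc _ ≤ M / b 0 * (5 / 4 * n) * n := mul_le_mul_of_nonneg_right h1 hn.le
      _ = 10 / 3 * (M / b 0) * (3 / 4 * n * ((n : ℝ) / 2)) := by ring
      _ ≤ _ := mul_le_mul_of_nonneg_left h6 (by positivity)
  have hq1 : |1 - (X - g 0 ^ 2) / (V - y)| ≤ 6 * M / √(n : ℝ) := by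
    rw [one_sub_div hV20.ne', abs_div, abs_of_pos hV20, div_le_div_iff₀ hV20 hs0]
    have h1 : |V - y - (X - g 0 ^ 2)| ≤ 3 * (M * √(n : ℝ)) := by
      have h2 := hg.1
      have h3 := hg.2.1
      change |X - n| ≤ _ at h2
      change |V - n| ≤ _ at h3
      rw [abs_le] at h2 h3 ⊢
      have h4 : √(n : ℝ) ≤ M * √(n : ℝ) := le_mul_of_one_le_left hs0.le hM
      constructor <;> linarith
    calc _ ≤ 3 * (M * √(n : ℝ)) * √(n : ℝ) := mul_le_mul_of_nonneg_right h1 hs0.le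
      _ = 6 * M * (n / 2) := by rw [mul_assoc, mul_assoc, hsn]; ring
      _ ≤ _ := mul_le_mul_of_nonneg_left hVl (by positivity)
  unfold tilt
  rw [hX'e, hV'e]
  change |Real.exp (n / 2 * (1 - X / V + Real.log (X / V))) - _| ≤ _
  set p := X / V with hp
  set q := (X - g 0 ^ 2) / (V - y) with hq
  have hp0 : 0 < p := div_pos hX0 hV0
  have hq0 : 0 < q := div_pos hX20 hV20
  have hp25 : 2 / 5 ≤ p := by rw [hp, le_div_iff₀ hV0]; linarith
  have hq25 : 2 / 5 ≤ q := by rw [hq, le_div_iff₀ hV20]; linarith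
  have hψ : ∀ x : ℝ, 0 < x → (n : ℝ) / 2 * (1 - x + Real.log x) ≤ 0 := fun x hx =>
    mul_nonpos_of_nonneg_of_nonpos (by positivity) (by linarith [Real.log_le_sub_one_of_pos hx])
  refine (abs_exp_sub_exp_le (hψ p hp0) (hψ q hq0)).trans ?_
  rw [← mul_sub, abs_mul, abs_of_pos (by positivity : (0 : ℝ) < n / 2)]
  have hfac : ∀ x : ℝ, 2 / 5 ≤ x → |1 - x| ≤ 6 * M / √(n : ℝ) →
      |1 - x| / x ≤ 15 * M / √(n : ℝ) := fun x hx h => by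
    rw [div_le_iff₀ (by linarith)]
    have h0 : 0 ≤ M / √(n : ℝ) := by positivity
    have e1 : 6 * M / √(n : ℝ) = 6 * (M / √(n : ℝ)) := by ring
    have e2 : 15 * M / √(n : ℝ) = 15 * (M / √(n : ℝ)) := by ring
    rw [e1] at h
    rw [e2]
    nlinarith
  have hp1' : |1 - p| ≤ 6 * M / √(n : ℝ) := by
    rw [abs_sub_comm]
    refine hp1.trans (div_le_div_of_nonneg_right ?_ hs0.le)
    linarith
  have hmain : |(1 - p + Real.log p) - (1 - q + Real.log q)| ≤
      10 / 3 * (M / b 0) / n * (15 * M / √(n : ℝ)) := by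
    rw [abs_le']
    constructor
    · exact (log_sub_self_sub_le hp0 hq0).trans
        (mul_le_mul hpq (hfac q hq25 hq1) (by positivity) (by positivity))
    · rw [neg_sub]
      refine (log_sub_self_sub_le hq0 hp0).trans ?_
      rw [abs_sub_comm]
      exact mul_le_mul hpq (hfac p hp25 hp1') (by positivity) (by positivity)
  calc _ ≤ (n : ℝ) / 2 * (10 / 3 * (M / b 0) / n * (15 * M / √(n : ℝ))) :=
        mul_le_mul_of_nonneg_left hmain (by positivity)
    _ = _ := by field_simp; ring

end Comparison
end SpinChain

/-! ### Quantitative Gaussian approximation -/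

namespace SpinChain

section Quantitative

theorem abs_integral_le_of_bound_on {Ω : Type*} [MeasurableSpace Ω] {P : Measure Ω}
    [IsProbabilityMeasure P] {f : Ω → ℝ} {A : Set Ω} (hA : MeasurableSet A) {c C : ℝ} (hc : 0 ≤ c)
    (h1 : ∀ x ∈ A, |f x| ≤ c) (h2 : ∀ᵐ x ∂P, |f x| ≤ C) :
    |∫ x, f x ∂P| ≤ c + C * P.real Aᶜ := by
  have hint : Integrable (fun x => c + Aᶜ.indicator (fun _ => C) x) P :=
    (integrable_const c).add ((integrable_const C).indicator hA.compl)
  have h := norm_integral_le_of_norm_le hint (f := f) (by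
    filter_upwards [h2] with x hx
    by_cases hxA : x ∈ A
    · simpa [hxA] using h1 x hxA
    · simp only [Set.indicator_of_mem (Set.mem_compl hxA)]
      rw [Real.norm_eq_abs]
      linarith)
  rw [integral_add (integrable_const c) ((integrable_const C).indicator hA.compl),
    integral_indicator_const _ hA.compl, integral_const] at h
  simpa [mul_comm] using h

variable {n : ℕ} [NeZero n]

/-- Independence of the coordinate of frequency `0` from the other coordinates. -/
theorem integral_mul_update_zero {φ : ℝ → ℝ} (hφ : Measurable φ) {w : (Fin n → ℝ) → ℝ}
    (hw : Measurable w) :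
    ∫ g, φ (g 0) * w (Function.update g 0 0) ∂gaussianSpins n =
      (∫ x, φ x ∂gaussianReal 0 1) * ∫ g, w (Function.update g 0 0) ∂gaussianSpins n := by
  have hI : iIndepFun (fun (i : Fin n) (g : Fin n → ℝ) => g i) (gaussianSpins n) :=
    iIndepFun_pi (μ := fun _ : Fin n => gaussianReal 0 1) (X := fun _ x => x)
      fun _ => aemeasurable_id
  have hI2 := hI.indepFun_finset {0} {0}ᶜ disjoint_compl_right fun i => by fun_prop
  have h1 : Measurable fun t : (({0} : Finset (Fin n)) → ℝ) =>
      φ (t ⟨0, Finset.mem_singleton_self _⟩) := by fun_prop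
  have h2 : Measurable fun t : (({0}ᶜ : Finset (Fin n)) → ℝ) =>
      w (fun k => if h : k ∈ ({0}ᶜ : Finset (Fin n)) then t ⟨k, h⟩ else 0) := by
    refine hw.comp (measurable_pi_lambda _ fun k => ?_)
    by_cases h : k ∈ ({0}ᶜ : Finset (Fin n))
    · simp only [h, dite_true]; fun_prop
    · simp only [h, dite_false]; fun_prop
  have h3 := (hI2.comp h1 h2).integral_fun_mul_eq_mul_integral
    (h1.comp (by fun_prop)).aestronglyMeasurable (h2.comp (by fun_prop)).aestronglyMeasurable
  have e : ∀ g : Fin n → ℝ, (fun k => if k ∈ ({0}ᶜ : Finset (Fin n)) then g k else 0) =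
      Function.update g 0 0 := fun g => by
    funext k
    by_cases hk : k = 0
    · subst hk; simp
    · simp [hk]
  simp only [Function.comp, dite_eq_ite, e] at h3
  rw [h3]
  congr 1
  exact integral_comp_eval (μ := fun _ : Fin n => gaussianReal 0 1) (i := 0)
    hφ.aestronglyMeasurable

theorem integrable_tilt {b : Fin n → ℝ} (hb : ∀ k, 0 < b k) :
    Integrable (tilt b) (gaussianSpins n) :=
  Integrable.of_bound (measurable_tilt b).aestronglyMeasurable 1 (by
    filter_upwards [normSq_pos_ae] with g hg
    rw [Real.norm_of_nonneg (tilt_pos b g).le]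
    exact tilt_le_one hb hg)

theorem exp_neg_div_two_le_integral_tilt {b : Fin n → ℝ} (hb : ∀ k, 0 < b k)
    (h1 : ∑ k, 1 / b k = n) (h2 : ∑ k, (1 / b k) ^ 2 ≤ 4 * (n : ℝ)) {M : ℝ} (hM : 1 ≤ M)
    (hMv : 2 * (5 * varSq + 1) ≤ M) (hMn : 4 * M ≤ √(n : ℝ)) :
    Real.exp (-(6 * M ^ 2)) / 2 ≤ ∫ g, tilt b g ∂gaussianSpins n := by
  have hm := measurableSet_typicalSet b M
  have hprob : 1 / 2 ≤ (gaussianSpins n).real (typicalSet b M) := by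
    have h3 := measure_compl_typicalSet_le h1 h2 hM
    rw [probReal_compl_eq_one_sub hm] at h3
    have h4 : (5 * varSq + 1) / M ≤ 1 / 2 := by
      rw [div_le_div_iff₀ (by positivity) (by norm_num)]; linarith
    linarith
  calc Real.exp (-(6 * M ^ 2)) / 2
      ≤ ∫ g, (typicalSet b M).indicator (fun _ => Real.exp (-(6 * M ^ 2))) g
          ∂gaussianSpins n := by
        rw [integral_indicator_const _ hm, smul_eq_mul]
        have := Real.exp_pos (-(6 * M ^ 2))
        nlinarith
    _ ≤ _ := by
        refine integral_mono ((integrable_const _).indicator hm) (integrable_tilt hb) fun g => ?_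
        by_cases hg : g ∈ typicalSet b M
        · rw [Set.indicator_of_mem hg]; exact exp_neg_le_tilt hMn hg
        · rw [Set.indicator_of_notMem hg]; exact (tilt_pos b g).le

theorem abs_sqrt_normSq_div_sub_one_le {b : Fin n → ℝ} (hb : ∀ k, 0 < b k) {M : ℝ}
    (hM : 4 * M ≤ √(n : ℝ)) {g g' : Fin n → ℝ} (hg : g ∈ typicalSet b M)
    (hg' : g' ∈ typicalSet b M) :
    |√(normSq g') / √(scaledNormSq b g) - 1| ≤ 8 / 3 * M / √(n : ℝ) := by
  have hx0 : 0 ≤ normSq g' / scaledNormSq b g :=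
    div_nonneg (normSq_nonneg _) (scaledNormSq_nonneg hb _)
  refine le_trans ?_ (abs_normSq_div_sub_one_le hM hg hg')
  rw [← Real.sqrt_div (normSq_nonneg _)]
  set x := normSq g' / scaledNormSq b g
  have hsx := Real.sqrt_nonneg x
  have : x - 1 = (√x - 1) * (√x + 1) := by
    have := Real.mul_self_sqrt hx0
    linarith
  rw [this, abs_mul, abs_of_pos (by linarith : 0 < √x + 1)]
  nlinarith [abs_nonneg (√x - 1)]

set_option maxHeartbeats 400000 in
/-- Quantitative comparison between the magnetization and its Gaussian limit. The factor on the
left is a lower bound for the total mass of the tilt. -/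
theorem abs_integral_spinLaw_sub_mul_le {r : ℕ} (hr : r ≠ 0) (hrn : r < n) {ε : ℝ} (hε : 0 < ε)
    (hε1 : ε ≤ 1) (hres : resolventTrace n r ε = n) {q : ℝ} (hq : 0 < q) {F : ℝ → ℝ} {L : ℝ≥0}
    (hF : LipschitzWith L F) {B : ℝ} (hB : ∀ x, |F x| ≤ B) {M M₀ : ℝ} (hM : 1 ≤ M)
    (hMε : M / (ε * √(n : ℝ)) ≤ 1 / 4) (hM₀ : 1 ≤ M₀) (hM₀' : 2 * (5 * varSq + 1) ≤ M₀)
    (hM₀n : 4 * M₀ ≤ √(n : ℝ)) :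
    |∫ x, F (magnetization n x / (q * √(n : ℝ))) ∂spinLaw n r -
        ∫ x, F (x / (√ε * q)) ∂gaussianReal 0 1| * (Real.exp (-(6 * M₀ ^ 2)) / 2) ≤
      (3 * L / (√ε * q) + 50 * B) * (M ^ 2 / (ε * √(n : ℝ))) +
        5 * B * ((5 * varSq + 1) / M) := by
  have hn : (0 : ℝ) < n := by exact_mod_cast NeZero.pos n
  have hs0 : 0 < √(n : ℝ) := Real.sqrt_pos.2 hn
  have hB0 : 0 ≤ B := (abs_nonneg _).trans (hB 0)
  have hFm : Measurable F := hF.continuous.measurable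
  set b : Fin n → ℝ := fun k => 1 + ε - eigenvalue n r k with hb
  have hbpos : ∀ k, 0 < b k := fun k => resolvent_denom_pos hε _
  have hb0 : b 0 = ε := by simp [hb, eigenvalue_zero n hr]
  have hres2 : ∑ k, (1 / b k) ^ 2 ≤ 4 * (n : ℝ) := sum_resolvent_sq_le hrn hε hres
  set K : ℝ := 5 * varSq + 1 with hK
  have hKpos : 0 < K := by have := varSq_nonneg; positivity
  have hMb : M / (b 0 * √(n : ℝ)) ≤ 1 / 4 := by rw [hb0]; exact hMε
  have hM4 : 4 * M ≤ √(n : ℝ) := by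
    rw [div_le_div_iff₀ (by positivity) (by norm_num)] at hMε
    nlinarith
  set γ := gaussianSpins n with hγ
  set A := typicalSet b M
  have hAm : MeasurableSet A := measurableSet_typicalSet b M
  have hAprob : γ.real Aᶜ ≤ K / M := measure_compl_typicalSet_le hres hres2 hM
  set W : (Fin n → ℝ) → ℝ := tilt b
  set W' : (Fin n → ℝ) → ℝ := fun g => min 1 (tilt b (Function.update g 0 0))
  have hWm : Measurable W := measurable_tilt b
  have hupd : Measurable fun g : Fin n → ℝ => Function.update g 0 0 := by
    refine measurable_pi_lambda _ fun k => ?_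
    by_cases hk : k = 0
    · subst hk; simp
    · simp only [Function.update_of_ne hk]; fun_prop
  have hW'm : Measurable W' := measurable_const.min (hWm.comp hupd)
  have hW0 : ∀ g, 0 ≤ W g := fun g => (tilt_pos b g).le
  have hW1 : ∀ᵐ g ∂γ, W g ≤ 1 := by
    filter_upwards [normSq_pos_ae] with g hg using tilt_le_one hbpos hg
  have hW'0 : ∀ g, 0 ≤ W' g := fun g => le_min zero_le_one (tilt_pos b _).le
  have hW'1 : ∀ g, W' g ≤ 1 := fun g => min_le_left _ _
  have hWint : Integrable W γ := integrable_tilt hbpos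
  have hW'int : Integrable W' γ := Integrable.of_bound hW'm.aestronglyMeasurable 1
    (Eventually.of_forall fun g => by rw [Real.norm_of_nonneg (hW'0 g)]; exact hW'1 g)
  set c₂ := 25 * M ^ 2 / (ε * √(n : ℝ)) with hc₂
  have hc₂0 : 0 ≤ c₂ := by positivity
  have hWW' : ∀ g ∈ A, |W g - W' g| ≤ c₂ := fun g hg => by
    have := abs_tilt_sub_tilt_update_le hbpos (by rw [hb0]; exact hε1) hM hMb hg
    rwa [hb0] at this
  set w := ∫ g, W g ∂γ with hw
  have hwlow : Real.exp (-(6 * M₀ ^ 2)) / 2 ≤ w :=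
    exp_neg_div_two_le_integral_tilt hbpos hres hres2 hM₀ hM₀' hM₀n
  have hw0 : 0 < w := lt_of_lt_of_le (by positivity) hwlow
  set a : (Fin n → ℝ) → ℝ := fun g => g 0 / (√ε * q) with ha
  have ham : Measurable a := by fun_prop
  set e := ∫ x, F (x / (√ε * q)) ∂gaussianReal 0 1
  set m := ∫ x, F (magnetization n x / (q * √(n : ℝ))) ∂spinLaw n r with hm
  have hεs : 0 < √ε := Real.sqrt_pos.2 hε
  set P := γ.prod γ
  set T : (Fin n → ℝ) × (Fin n → ℝ) → ℝ :=
    fun p => √(normSq p.2) / √(scaledNormSq b p.1) * a p.1 with hT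
  have hTm : Measurable T := by fun_prop
  have hmw : m * w = ∫ p, F (T p) * W p.1 ∂P := by
    have h := integral_magnetization_spinLaw r (1 + ε) b hbpos (fun k => rfl)
      (f := fun S => F (S / (q * √(n : ℝ)))) (by fun_prop)
    rw [hm, hw, hγ, h]
    refine integral_congr_ae (Eventually.of_forall fun p => ?_)
    simp only [hT, ha, hb0]
    congr 2
    field_simp
  have hew : e * ∫ g, W' g ∂γ = ∫ p, F (a p.1) * W' p.1 ∂P := by
    have h := integral_mul_update_zero (n := n) (φ := fun x => F (x / (√ε * q))) (by fun_prop)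
      (w := fun g => min 1 (tilt b g)) (by fun_prop)
    rw [integral_fun_fst (μ := γ) (ν := γ) fun g => F (a g) * W' g, probReal_univ, one_smul]
    exact h.symm
  have hfst : ∀ᵐ p ∂P, W p.1 ≤ 1 := Measure.quasiMeasurePreserving_fst.ae hW1
  have hint1 : Integrable (fun p => F (T p) * W p.1) P :=
    Integrable.of_bound (by fun_prop) (B * 1) (by
      filter_upwards [hfst] with p hp
      rw [norm_mul, Real.norm_of_nonneg (hW0 _), Real.norm_eq_abs]
      exact mul_le_mul (hB _) hp (hW0 _) hB0)
  have hint2 : Integrable (fun p => F (a p.1) * W' p.1) P :=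
    Integrable.of_bound (by fun_prop) (B * 1) (Eventually.of_forall fun p => by
      rw [norm_mul, Real.norm_of_nonneg (hW'0 _), Real.norm_eq_abs]
      exact mul_le_mul (hB _) (hW'1 _) (hW'0 _) hB0)
  set c₁ := 3 * L / (√ε * q) * (M ^ 2 / (ε * √(n : ℝ))) with hc₁
  have hc₁0 : 0 ≤ c₁ := by positivity
  have hFT : ∀ p ∈ A ×ˢ A, |F (T p) - F (a p.1)| ≤ c₁ := fun p hp => by
    obtain ⟨hp1, hp2⟩ := hp
    have h1 := hF.dist_le_mul (T p) (a p.1)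
    rw [Real.dist_eq, Real.dist_eq] at h1
    refine h1.trans ?_
    have h2 : T p - a p.1 = (√(normSq p.2) / √(scaledNormSq b p.1) - 1) * a p.1 := by
      simp only [hT]; ring
    have h3 := abs_sqrt_normSq_div_sub_one_le hbpos hM4 hp1 hp2
    have h4 : |a p.1| ≤ M / (√ε * q) := by
      simp only [ha]
      rw [abs_div, abs_of_pos (by positivity : 0 < √ε * q)]
      refine div_le_div_of_nonneg_right ?_ (by positivity)
      have h5 : p.1 0 ^ 2 ≤ M := hp1.2.2
      exact abs_le_of_sq_le_sq (by nlinarith) (by positivity)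
    have hinv : 1 / √(n : ℝ) ≤ 1 / (ε * √(n : ℝ)) :=
      one_div_le_one_div_of_le (by positivity) (by nlinarith)
    rw [h2, abs_mul]
    calc (L : ℝ) * (|√(normSq p.2) / √(scaledNormSq b p.1) - 1| * |a p.1|)
        ≤ L * (8 / 3 * M / √(n : ℝ) * (M / (√ε * q))) := by gcongr
      _ = 8 / 3 * (L / (√ε * q) * M ^ 2 * (1 / √(n : ℝ))) := by ring
      _ ≤ 3 * (L / (√ε * q) * M ^ 2 * (1 / (ε * √(n : ℝ)))) := by gcongr; norm_num
      _ = c₁ := by rw [hc₁]; ring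
  have hprod : P.real (A ×ˢ A)ᶜ ≤ 2 * (K / M) := by
    have hsub : (A ×ˢ A)ᶜ ⊆ (Prod.fst ⁻¹' Aᶜ) ∪ (Prod.snd ⁻¹' Aᶜ) := fun p hp => by
      by_contra hcon
      simp only [Set.mem_union, Set.mem_preimage, Set.mem_compl_iff, not_or, not_not] at hcon
      exact hp hcon
    have h1 : P.real (Prod.fst ⁻¹' Aᶜ) = γ.real Aᶜ :=
      measurePreserving_fst.measureReal_preimage hAm.compl.nullMeasurableSet
    have h2 : P.real (Prod.snd ⁻¹' Aᶜ) = γ.real Aᶜ :=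
      measurePreserving_snd.measureReal_preimage hAm.compl.nullMeasurableSet
    have h3 := (measureReal_mono (μ := P) hsub).trans (measureReal_union_le _ _)
    rw [h1, h2] at h3
    linarith
  have hD : |∫ p, (F (T p) * W p.1 - F (a p.1) * W' p.1) ∂P| ≤
      (c₁ + B * c₂) + 2 * B * P.real (A ×ˢ A)ᶜ := by
    refine abs_integral_le_of_bound_on (hAm.prod hAm) (by positivity) (fun p hp => ?_) ?_
    · have h0 : F (T p) * W p.1 - F (a p.1) * W' p.1 =
          (F (T p) - F (a p.1)) * W p.1 + F (a p.1) * (W p.1 - W' p.1) := by ring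
      have hX0 : 0 < normSq p.1 := by
        have := (typicalSet_bounds hM4 hp.1).1
        linarith
      rw [h0]
      refine (abs_add_le _ _).trans (add_le_add ?_ ?_)
      · rw [abs_mul, abs_of_nonneg (hW0 _)]
        exact (mul_le_of_le_one_right (abs_nonneg _) (tilt_le_one hbpos hX0)).trans (hFT p hp)
      · rw [abs_mul]
        exact mul_le_mul (hB _) (hWW' _ hp.1) (abs_nonneg _) hB0
    · filter_upwards [hfst] with p hp
      refine (abs_sub _ _).trans ?_
      rw [abs_mul, abs_mul, abs_of_nonneg (hW0 _), abs_of_nonneg (hW'0 _)]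
      have h1 := mul_le_mul (hB (T p)) hp (hW0 _) hB0
      have h2 := mul_le_mul (hB (a p.1)) (hW'1 p.1) (hW'0 _) hB0
      linarith
  have hdw : |∫ g, (W' g - W g) ∂γ| ≤ c₂ + 1 * γ.real Aᶜ := by
    refine abs_integral_le_of_bound_on hAm hc₂0 (fun g hg => ?_) ?_
    · rw [abs_sub_comm]; exact hWW' g hg
    · filter_upwards [hW1] with g hg
      rw [abs_le]
      constructor <;> linarith [hW0 g, hW'0 g, hW'1 g]
  have heB : |e| ≤ B := by
    have := abs_integral_le_of_bound_on (P := gaussianReal 0 1)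
      (f := fun x => F (x / (√ε * q))) MeasurableSet.univ hB0 (fun x _ => hB _)
      (C := B) (Eventually.of_forall fun x => hB _)
    simpa using this
  -- `e * ∫ W'` splits by independence, and `W'` is then replaced by `W`
  have hsplit : (m - e) * w = ∫ p, (F (T p) * W p.1 - F (a p.1) * W' p.1) ∂P +
      e * ∫ g, (W' g - W g) ∂γ := by
    rw [integral_sub hint1 hint2, integral_sub hW'int hWint, ← hmw, ← hew]
    ring
  have hfinal : |m - e| * w ≤ (c₁ + B * c₂) + 2 * B * (2 * (K / M)) + B * (c₂ + K / M) := by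
    rw [show |m - e| * w = |(m - e) * w| by rw [abs_mul, abs_of_pos hw0], hsplit]
    refine (abs_add_le _ _).trans (add_le_add (hD.trans ?_) ?_)
    · have := mul_le_mul_of_nonneg_left hprod (by positivity : 0 ≤ 2 * B)
      linarith
    · rw [abs_mul]
      exact mul_le_mul heB (hdw.trans (by linarith)) (abs_nonneg _) hB0
  calc _ ≤ |m - e| * w := mul_le_mul_of_nonneg_left hwlow (abs_nonneg _)
    _ ≤ _ := hfinal
    _ = _ := by rw [hc₁, hc₂]; ring

end Quantitative
end SpinChain

/-! ### Convergence in distribution -/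

namespace SpinChain

/-- Weak continuity of the centred normal law in its standard deviation. -/
theorem tendsto_integral_comp_mul_gaussianReal {ι : Type*} {l : Filter ι} [l.IsCountablyGenerated]
    {F : ℝ → ℝ} (hF : Continuous F) {B : ℝ} (hB : ∀ x, |F x| ≤ B) {c : ι → ℝ} {v : ℝ≥0}
    (hc : Tendsto c l (𝓝 √(v : ℝ))) :
    Tendsto (fun i => ∫ x, F (c i * x) ∂gaussianReal 0 1) l
      (𝓝 (∫ x, F x ∂gaussianReal 0 v)) := by
  have hv : gaussianReal 0 v = (gaussianReal 0 1).map (√(v : ℝ) * ·) := by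
    rw [gaussianReal_map_const_mul]
    congr 1
    · simp
    · ext; simp
  rw [hv, integral_map (by fun_prop) hF.aestronglyMeasurable]
  refine tendsto_integral_filter_of_dominated_convergence (fun _ => B)
    (Eventually.of_forall fun i => (hF.comp (by fun_prop)).aestronglyMeasurable)
    (Eventually.of_forall fun i => Eventually.of_forall fun x => hB _) (integrable_const B)
    (Eventually.of_forall fun x => (hF.tendsto _).comp (hc.mul_const x))

end SpinChain

theorem theorem4 (r : ℕ+ → ℕ)
    (hr_large : Tendsto (fun n : ℕ+ => (r n : ℝ) / √(n : ℝ)) atTop atTop)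
    (hr_small : Tendsto (fun n : ℕ+ => (r n : ℝ) / (n : ℝ) ^ (3 / 4 : ℝ)) atTop (𝓝 0)) :
    TendstoInDistribution
      (fun (n : ℕ+) (x : Fin n → ℝ) =>
        SpinChain.magnetization n x / ((r n : ℝ) ^ (1 / 3 : ℝ) * √(n : ℝ)))
      atTop
      (id : ℝ → ℝ)
      (fun n : ℕ+ => SpinChain.spinLaw n (r n))
      (gaussianReal 0 ((2 / 3 : ℝ≥0) ^ (1 / 3 : ℝ))) := by
  have hSm : ∀ n : ℕ+, Measurable fun x : Fin n → ℝ =>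
      SpinChain.magnetization n x / ((r n : ℝ) ^ (1 / 3 : ℝ) * √(n : ℝ)) := fun n => by
    unfold SpinChain.magnetization; fun_prop
  refine ⟨fun n => (hSm n).aemeasurable, aemeasurable_id, ?_⟩
  refine tendsto_iff_forall_lipschitz_integral_tendsto.2 ?_
  rintro F ⟨C, hC⟩ ⟨L, hL⟩
  obtain ⟨B, hB⟩ : ∃ B, ∀ x, |F x| ≤ B := ⟨C + |F 0|, fun x => by
    have h1 := hC x 0
    rw [Real.dist_eq] at h1
    have h2 := abs_sub_abs_le_abs_sub (F x) (F 0)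
    linarith⟩
  have hn0 : ∀ n : ℕ+, (0 : ℝ) < (n : ℝ) := fun n => by exact_mod_cast n.pos
  have hn1 : ∀ n : ℕ+, (1 : ℝ) ≤ (n : ℝ) := fun n => by exact_mod_cast n.2
  have hnat : Tendsto (fun n : ℕ+ => (n : ℝ)) atTop atTop := 
    tendsto_natCast_atTop_atTop.comp tendsto_PNat_val_atTop_atTop
  have hsqrt : Tendsto (fun n : ℕ+ => √(n : ℝ)) atTop atTop := Real.tendsto_sqrt_atTop.comp hnat
  have hrtop : Tendsto (fun n : ℕ+ => (r n : ℝ)) atTop atTop := by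
    refine tendsto_atTop_mono (fun n => ?_) hr_large
    exact div_le_self (Nat.cast_nonneg _) (Real.one_le_sqrt.2 (hn1 n))
  set ρ : ℕ+ → ℝ := fun n => (r n : ℝ) ^ (2 / 3 : ℝ) with hρ
  have hρtop : Tendsto ρ atTop atTop := (tendsto_rpow_atTop (by norm_num)).comp hrtop
  have hρ3 : ∀ n, ρ n ^ 3 = (r n : ℝ) ^ 2 := fun n => by
    rw [hρ, ← Real.rpow_natCast, ← Real.rpow_mul (Nat.cast_nonneg _), ← Real.rpow_natCast]
    norm_num
  have hmesh : Tendsto (fun n : ℕ+ => ρ n ^ 2 / (n : ℝ)) atTop (𝓝 0) := by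
    have h1 : Tendsto (fun n : ℕ+ => ((r n : ℝ) / (n : ℝ) ^ (3 / 4 : ℝ)) ^ (4 / 3 : ℝ)) atTop
        (𝓝 (0 ^ (4 / 3 : ℝ))) := hr_small.rpow_const (Or.inr (by norm_num))
    rw [Real.zero_rpow (by norm_num)] at h1
    refine h1.congr fun n => ?_
    rw [Real.div_rpow (Nat.cast_nonneg _) (Real.rpow_nonneg (hn0 n).le _),
      ← Real.rpow_mul (hn0 n).le, hρ, ← Real.rpow_natCast, ← Real.rpow_mul (Nat.cast_nonneg _)]
    norm_num
  have hr2 : ∀ᶠ n : ℕ+ in atTop, 2 ≤ r n := by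
    filter_upwards [hrtop.eventually_ge_atTop 2] with n hn
    exact_mod_cast hn
  have hrn : ∀ᶠ n : ℕ+ in atTop, r n < n := by
    filter_upwards [hr_small.eventually_lt_const one_pos] with n hn
    rw [div_lt_one (Real.rpow_pos_of_pos (hn0 n) _)] at hn
    have h1 : (n : ℝ) ^ (3 / 4 : ℝ) ≤ (n : ℝ) ^ (1 : ℝ) :=
      Real.rpow_le_rpow_of_exponent_le (hn1 n) (by norm_num)
    rw [Real.rpow_one] at h1
    have h2 : (r n : ℝ) < (n : ℕ) := hn.trans_le h1
    exact_mod_cast h2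
  have hex : ∀ n : ℕ+, ∃ ε : ℝ, r n ≠ 0 →
      0 < ε ∧ ε ≤ 1 ∧ SpinChain.resolventTrace n (r n) ε = (n : ℕ) := fun n => by
    by_cases h : r n = 0
    · exact ⟨0, fun h' => absurd h h'⟩
    · obtain ⟨ε, hε⟩ := SpinChain.exists_resolventTrace_eq (n := n) h
      exact ⟨ε, fun _ => hε⟩
  choose ε hε using hex
  have hε' : ∀ᶠ n : ℕ+ in atTop, 0 < ε n ∧ ε n ≤ 1 ∧
      SpinChain.resolventTrace n (r n) (ε n) = (n : ℕ) := by
    filter_upwards [hr2] with n hn using hε n (by omega)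
  set A : ℝ := (3 / 2) ^ (1 / 3 : ℝ) with hA
  have hA0 : 0 < A := by positivity
  have hsaddle : Tendsto (fun n => ε n * ρ n) atTop (𝓝 A) :=
    SpinChain.tendsto_saddle (N := fun n : ℕ+ => (n : ℕ)) (fun n => n.ne_zero) hr2 hrn hρ3 hρtop
      hmesh (hε'.mono fun n h => h.1) (hε'.mono fun n h => h.2.2)
  -- the standard deviation of the coordinate of frequency `0`, rescaled by `r ^ (1 / 3)`
  set σ : ℕ+ → ℝ := fun n => (√(ε n) * (r n : ℝ) ^ (1 / 3 : ℝ))⁻¹ with hσ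
  have hσlim : Tendsto σ atTop (𝓝 √(((2 / 3 : ℝ≥0) ^ (1 / 3 : ℝ) : ℝ≥0) : ℝ)) := by
    have h1 : Tendsto (fun n => √(ε n * ρ n)⁻¹) atTop (𝓝 √(A⁻¹)) := (hsaddle.inv₀ hA0.ne').sqrt
    have h2 : A⁻¹ = (((2 / 3 : ℝ≥0) ^ (1 / 3 : ℝ) : ℝ≥0) : ℝ) := by
      rw [hA, ← Real.inv_rpow (by norm_num), NNReal.coe_rpow]
      norm_num
    rw [← h2]
    refine h1.congr fun n => ?_
    have h3 : ρ n = ((r n : ℝ) ^ (1 / 3 : ℝ)) ^ 2 := by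
      rw [hρ, ← Real.rpow_natCast, ← Real.rpow_mul (Nat.cast_nonneg _)]
      norm_num
    rw [hσ, Real.sqrt_inv, h3, Real.sqrt_mul' _ (sq_nonneg _),
      Real.sqrt_sq (Real.rpow_nonneg (Nat.cast_nonneg _) _)]
  set κ : ℕ+ → ℝ := fun n => (ε n * √(n : ℝ))⁻¹ with hκ
  have hκlim : Tendsto κ atTop (𝓝 0) := by
    have h1 : Tendsto (fun n : ℕ+ => √(ρ n ^ 2 / (n : ℝ)) * (ε n * ρ n)⁻¹) atTop (𝓝 (0 * A⁻¹)) := by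
      have := hmesh.sqrt
      rw [Real.sqrt_zero] at this
      exact this.mul (hsaddle.inv₀ hA0.ne')
    rw [zero_mul] at h1
    refine h1.congr' ?_
    filter_upwards [hρtop.eventually_gt_atTop 0] with n hn
    rw [Real.sqrt_div (sq_nonneg _), Real.sqrt_sq hn.le, hκ]
    field_simp
  have hκpos : ∀ᶠ n in atTop, 0 < κ n := by
    filter_upwards [hε'] with n hn
    have := hn0 n
    have := hn.1
    positivity
  -- the deviation `M = κ ^ (-1 / 3)` tends to infinity slowly enough for `M² κ` to tend to zero
  set u : ℕ+ → ℝ := fun n => κ n ^ (1 / 3 : ℝ) with hu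
  have hulim : Tendsto u atTop (𝓝 0) := by
    have := hκlim.rpow_const (p := (1 / 3 : ℝ)) (Or.inr (by norm_num))
    rwa [Real.zero_rpow (by norm_num)] at this
  have hupos : ∀ᶠ n in atTop, 0 < u n := hκpos.mono fun n hn => Real.rpow_pos_of_pos hn _
  have hu3 : ∀ᶠ n in atTop, κ n = u n ^ 3 := hκpos.mono fun n hn => by
    rw [hu, ← Real.rpow_natCast, ← Real.rpow_mul hn.le]
    norm_num
  set M₀ : ℝ := 1 + 2 * (5 * SpinChain.varSq + 1) with hM₀
  have hv := SpinChain.varSq_nonneg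
  have hM₀1 : 1 ≤ M₀ := by rw [hM₀]; linarith
  have hM₀v : 2 * (5 * SpinChain.varSq + 1) ≤ M₀ := by rw [hM₀]; linarith
  have hkey : ∀ᶠ n : ℕ+ in atTop,
      |∫ x, F (SpinChain.magnetization n x / ((r n : ℝ) ^ (1 / 3 : ℝ) * √(n : ℝ)))
          ∂SpinChain.spinLaw n (r n) - ∫ x, F (σ n * x) ∂gaussianReal 0 1| ≤
        ((3 * L * σ n + 50 * B) * u n + 5 * B * ((5 * SpinChain.varSq + 1) * u n)) /
          (Real.exp (-(6 * M₀ ^ 2)) / 2) := by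
    filter_upwards [hr2, hrn, hε', hupos, hu3, hulim.eventually_le_const (by norm_num :
      (0 : ℝ) < 1 / 4), hsqrt.eventually_ge_atTop (4 * M₀)] with n h2 h3 h4 h5 h6 h7 h8
    have hr0 : r n ≠ 0 := by omega
    have hq : 0 < (r n : ℝ) ^ (1 / 3 : ℝ) := Real.rpow_pos_of_pos (by positivity) _
    have hdiv : ∀ x, x / (ε n * √(n : ℝ)) = x * u n ^ 3 := fun x => by
      rw [← h6, hκ, div_eq_mul_inv]
    have h := SpinChain.abs_integral_spinLaw_sub_mul_le hr0 h3 h4.1 h4.2.1 h4.2.2 hq hL hB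
      (M := (u n)⁻¹) ((one_le_inv₀ h5).2 (by linarith))
      (by
        rw [hdiv]
        have : (u n)⁻¹ * u n ^ 3 = u n * u n := by field_simp
        rw [this]
        nlinarith) hM₀1 hM₀v h8
    rw [le_div_iff₀ (by positivity)]
    change _ ≤ (3 * L / (√(ε n) * (r n : ℝ) ^ (1 / 3 : ℝ)) + 50 * B) *
      ((u n)⁻¹ ^ 2 / (ε n * √(n : ℝ))) + _ at h
    rw [hdiv, show (u n)⁻¹ ^ 2 * u n ^ 3 = u n by field_simp, div_inv_eq_mul] at h
    have hσe : ∀ x, x / (√(ε n) * (r n : ℝ) ^ (1 / 3 : ℝ)) = σ n * x := fun x => by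
      rw [hσ, div_eq_mul_inv, mul_comm]
    simp_rw [hσe] at h
    exact h.trans_eq (by ring)
  have hzero : Tendsto (fun n => ((3 * L * σ n + 50 * B) * u n +
      5 * B * ((5 * SpinChain.varSq + 1) * u n)) / (Real.exp (-(6 * M₀ ^ 2)) / 2)) atTop (𝓝 0) := by
    have h1 := ((((hσlim.const_mul (3 * (L : ℝ))).add_const (50 * B)).mul hulim).add
      ((hulim.const_mul (5 * SpinChain.varSq + 1)).const_mul (5 * B))).div_const
        (Real.exp (-(6 * M₀ ^ 2)) / 2)
    simpa using h1
  have hdiff : Tendsto (fun n : ℕ+ => ∫ x, F (SpinChain.magnetization n x /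
      ((r n : ℝ) ^ (1 / 3 : ℝ) * √(n : ℝ))) ∂SpinChain.spinLaw n (r n) -
        ∫ x, F (σ n * x) ∂gaussianReal 0 1) atTop (𝓝 0) := squeeze_zero_norm' hkey hzero
  have hgauss := SpinChain.tendsto_integral_comp_mul_gaussianReal hL.continuous hB hσlim
  have hsum := hdiff.add hgauss
  simp only [sub_add_cancel, zero_add] at hsum
  convert hsum using 2
  · rename_i n
    exact integral_map (hSm n).aemeasurable hL.continuous.aestronglyMeasurable
  · rw [ProbabilityMeasure.coe_mk, Measure.map_id]
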